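/- **Setting.** Let $D,K$ be nonempty sets, $F\subseteq K^D$, $G$ a normed space, $S:F\to G$ a mapping, and $H_m=(\mathbb C^2)^{\otimes m}$ with canonical basis $|i\rangle$, $0\le i<2^m$. A *quantum query* is a tuple $Q=(m,m',m'',Z,\tau,\beta)$ with $m',m''\ge1$, $m'+m''\le m$, $\emptyset\ne Z\subseteq\{0,\dots,2^{m'}-1\}$ and arbitrary mappings $\tau:Z\to D$, $\beta:K\to\{0,\dots,2^{m''}-1\}$. For $f\in F$ it defines the unitary operator $Q_f$ on $H_m=H_{m'}\otimes H_{m''}\otimes H_{m-m'-m''}$ with $Q_f|i\rangle|x\rangle|y\rangle=|i\rangle|x\oplus\beta(f(\tau(i)))\rangle|y\rangle$ if $i\in Z$ (where $\oplus$ is addition modulo $2^{m''}$) and $Q_f|i\rangle|x\rangle|y\rangle=|i\rangle|x\rangle|y\rangle$ otherwise. A *quantum algorithm without measurement* is a query $Q$ with unitary operators $U_0,\dots,U_r$ on $H_m$, $r\ge0$; it uses $r$ queries and realizes $A_f=U_rQ_fU_{r-1}\cdots U_1Q_fU_0$. A *quantum algorithm* $A$ from $F$ to $G$ consists of $k\ge1$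 algorithms $A_0,\dots,A_{k-1}$ without measurement (with qubit numbers $m_l$), of start indices $b_l=b_l(x_0,\dots,x_{l-1})\in\{0,\dots,2^{m_l}-1\}$ that depend arbitrarily on the previous measurement results, and of an arbitrary mapping $\varphi$ from the result tuples to $G$. At input $f$ the results $(x_0,\dots,x_{k-1})$ occur with probability $\prod_{l}|\langle x_l|A_{l,f}|b_l(x_0,\dots,x_{l-1})\rangle|^2$, and the output is $\zeta=\varphi(x_0,\dots,x_{k-1})$; the number of queries of $A$ is the sum of those of the $A_l$. Put $$e(S,A,f)=\inf\{\varepsilon\ge0:\ \mathbf P\{\|S(f)-\zeta\|>\varepsilon\}\le 1/4\}$$ and let the *$n$-th minimal quantum query error* be $$e_n^{\rm q}(S,F)=\inf_A\ \sup_{f\in F}e(S,A,f),$$ where the infimum is over all quantum algorithms $A$ that use at most $n$ queries. For $N\in\mathbb N=\{1,2,\dots\}$ and $1\le p\le\infty$ let $L_p^N$ be the space of functions $f:\{0,\dots,N-1\}\to\mathbb R$ with norm $\|f\|=\big(\frac1N\sum_{i}|f(i)|^p\big)^{1/p}$ (and $\|f\|=\max_i|f(i)|$ if $p=\infty$), let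 $\mathcal B(L_p^N)$ be its closed unit ball, and let $J_{pq}^N:L_p^N\to L_q^N$ be the identity $f\mapsto f$. For functions $a,b$ of $n,N\in\mathbb N$ with values in $[0,\infty)$ write $a\asymp_{\log}b$ if there are constants $c_0,c_1,c_2>0$, $n_0\in\mathbb N$ and $\alpha_1,\alpha_2\in\mathbb R$ such that $$c_1(\log_2(N+n))^{\alpha_1}\,b(n,N)\le a(n,N)\le c_2(\log_2(N+n))^{\alpha_2}\,b(n,N)$$ for all $n,N\in\mathbb N$ with $n_0\le n\le c_0N$. **Theorem 1.** Let $1\le p,q\le\infty$ (with $1/\infty=2/\infty=0$). If $p<q$, then $$e_n^{\rm q}(J_{pq}^N,\mathcal B(L_p^N))\asymp_{\log}\min\left(\left(\frac Nn\right)^{2/p-2/q},\,N^{1/p-1/q}\right),$$ and if $p\ge q$, then $$e_n^{\rm q}(J_{pq}^N,\mathcal B(L_p^N))\asymp_{\log}1 .$$ The constants may depend on $p$ and $q$. -/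

import Mathlib

open scoped ENNReal NNReal

noncomputable section

namespace QuantumApprox

/-! ### Quantum queries and quantum algorithms

`H_m = (ℂ²)^{⊗ m}` is represented through its canonical basis `|i⟩`, `0 ≤ i < 2 ^ m`, so operators
on `H_m` are complex matrices indexed by `Fin (2 ^ m)`. -/

/-- A quantum query for functions `D → K`, a tuple `(m, m', m'', Z, τ, β)`: it acts on `m` qubits,
the first `mi = m'` of which hold the index and the next `mv = m''` of which receive the value. -/
structure Query (D K : Type*) where
  m : ℕ
  mi : ℕ
  mv : ℕ
  mi_pos : 1 ≤ mi
  mv_pos : 1 ≤ mv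
  le : mi + mv ≤ m
  Z : Set (Fin (2 ^ mi))
  Z_nonempty : Z.Nonempty
  τ : Z → D
  β : K → Fin (2 ^ mv)

namespace Query

variable {D K : Type*} (Q : Query D K)

theorem two_pow_eq : 2 ^ Q.m = 2 ^ Q.mi * (2 ^ Q.mv * 2 ^ (Q.m - Q.mi - Q.mv)) := by
  have h := Q.le
  rw [← pow_add, ← pow_add]
  congr 1
  omega

/-- The identification of basis vectors `C_m = C_{m'} ⊗ C_{m''} ⊗ C_{m-m'-m''}`; it sends the number
`i * 2 ^ (m - m') + x * 2 ^ (m - m' - m'') + y` to `(i, x, y)`. -/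
def split : Fin (2 ^ Q.m) ≃ Fin (2 ^ Q.mi) × Fin (2 ^ Q.mv) × Fin (2 ^ (Q.m - Q.mi - Q.mv)) :=
  (finCongr Q.two_pow_eq).trans
    (finProdFinEquiv.symm.trans ((Equiv.refl _).prodCongr finProdFinEquiv.symm))

open Classical in
/-- The action of `Q_f` on basis vectors: `|i⟩|x⟩|y⟩ ↦ |i⟩|x ⊕ β(f(τ(i)))⟩|y⟩` if `i ∈ Z`, with
addition modulo `2 ^ m''` (this is the addition of `Fin`), and `|i⟩|x⟩|y⟩` is fixed otherwise. -/
def act (f : D → K) (s : Fin (2 ^ Q.m)) : Fin (2 ^ Q.m) :=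
  if h : (Q.split s).1 ∈ Q.Z then
    Q.split.symm ((Q.split s).1, (Q.split s).2.1 + Q.β (f (Q.τ ⟨(Q.split s).1, h⟩)),
      (Q.split s).2.2)
  else s

/-- The matrix of the operator `Q_f` in the canonical basis. -/
def mat (f : D → K) : Matrix (Fin (2 ^ Q.m)) (Fin (2 ^ Q.m)) ℂ :=
  Matrix.of fun x y => if x = Q.act f y then 1 else 0

end Query

/-- `alternate q n U = U_n q U_{n-1} ⋯ U_1 q U_0`. -/
def alternate {ι : Type*} [Fintype ι] (q : Matrix ι ι ℂ) :
    (n : ℕ) → (Fin (n + 1) → Matrix ι ι ℂ) → Matrix ι ι ℂ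
  | 0, U => U 0
  | n + 1, U => U (Fin.last (n + 1)) * q * alternate q n (fun j => U j.castSucc)

/-- A quantum algorithm with no measurement: a query and unitary operators `U_0, …, U_n`. -/
structure PureAlgorithm (D K : Type*) where
  Q : Query D K
  n : ℕ
  U : Fin (n + 1) → Matrix.unitaryGroup (Fin (2 ^ Q.m)) ℂ

namespace PureAlgorithm

variable {D K : Type*} (A : PureAlgorithm D K)

/-- The number of qubits. -/
def m : ℕ := A.Q.m

/-- The matrix `A_f(x, y)` of `A_f = U_n Q_f U_{n-1} ⋯ U_1 Q_f U_0` in the canonical basis. -/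
def mat (f : D → K) : Matrix (Fin (2 ^ A.m)) (Fin (2 ^ A.m)) ℂ :=
  alternate (A.Q.mat f) A.n (fun j => (A.U j : Matrix (Fin (2 ^ A.Q.m)) (Fin (2 ^ A.Q.m)) ℂ))

end PureAlgorithm

/-- A quantum algorithm with `k ≥ 1` measurements. The start state `b l` of the `l`-th part is
chosen from the results of the previous measurements (so `b 0` is just one basis state), and `φ`
computes the output from all measurement results. -/
structure Algorithm (D K G : Type*) where
  k : ℕ
  k_pos : 1 ≤ k
  A : Fin k → PureAlgorithm D K
  b : (l : Fin k) → ((i : Fin k) → i < l → Fin (2 ^ (A i).m)) → Fin (2 ^ (A l).m)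
  φ : ((l : Fin k) → Fin (2 ^ (A l).m)) → G

namespace Algorithm

variable {D K G : Type*} (A : Algorithm D K G)

/-- The number `n_q(A)` of queries. -/
def queries : ℕ := ∑ l, (A.A l).n

/-- The probability `p_{A,f}(x_0, …, x_{k-1})` of the measurement results `x_0, …, x_{k-1}`. -/
def resultProb (f : D → K) (x : (l : Fin A.k) → Fin (2 ^ (A.A l).m)) : ℝ :=
  ∏ l, ‖(A.A l).mat f (x l) (A.b l fun i _ => x i)‖ ^ 2

open Classical in
/-- The probability `A(f)(C)` that the output of `A` at input `f` lies in `C`. -/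
def outputProb (f : D → K) (C : Set G) : ℝ :=
  ∑ x, if A.φ x ∈ C then A.resultProb f x else 0

end Algorithm

/-! ### Errors -/

section Errors

variable {D K G : Type*} [NormedAddCommGroup G] {F : Set (D → K)}

/-- `e(S, A, f, θ)`, the infimum of all `ε ≥ 0` such that `A` at input `f` misses `S f` by more
than `ε` with probability at most `θ`. -/
def errorAt (S : F → G) (A : Algorithm D K G) (f : F) (θ : ℝ) : ℝ≥0∞ :=
  ⨅ (ε : ℝ≥0) (_ : A.outputProb f {g | (ε : ℝ) < ‖S f - g‖} ≤ θ), (ε : ℝ≥0∞)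

/-- `e(S, A, F, θ)`, the worst case error over `F`; the value `∞` is allowed. -/
def error (S : F → G) (A : Algorithm D K G) (θ : ℝ) : ℝ≥0∞ :=
  ⨆ f : F, errorAt S A f θ

/-- `e_n^q(S, F, θ)`. -/
def minErrorWith (n : ℕ) (S : F → G) (θ : ℝ) : ℝ≥0∞ :=
  ⨅ (A : Algorithm D K G) (_ : A.queries ≤ n), error S A θ

/-- The `n`-th minimal query error `e_n^q(S, F) = e_n^q(S, F, 1/4)`. -/
def minError (n : ℕ) (S : F → G) : ℝ≥0∞ :=
  minErrorWith n S (1 / 4)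

end Errors

/-! ### The spaces `L_p^N` -/

/-- The space `L_p^N` of all functions `{0, …, N-1} → ℝ`. -/
def LpN (_p : ℝ≥0∞) (N : ℕ) : Type := Fin N → ℝ

namespace LpN

variable {p : ℝ≥0∞} {N : ℕ}

instance : AddCommGroup (LpN p N) := inferInstanceAs (AddCommGroup (Fin N → ℝ))

instance : Module ℝ (LpN p N) := inferInstanceAs (Module ℝ (Fin N → ℝ))

variable (p N) in
/-- A function, regarded as an element of `L_p^N`. -/
def of : (Fin N → ℝ) ≃ₗ[ℝ] LpN p N := LinearEquiv.refl ℝ (Fin N → ℝ)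

/-- `(N⁻¹ ∑ |f i| ^ p) ^ (1 / p)` if `p < ∞`, and `max |f i|` if `p = ∞`. -/
instance : Norm (LpN p N) where
  norm f :=
    if p = ∞ then ⨆ i, |(of p N).symm f i|
    else ((1 / N : ℝ) * ∑ i, |(of p N).symm f i| ^ p.toReal) ^ (1 / p.toReal)

theorem norm_def (f : LpN p N) : ‖f‖ =
    if p = ∞ then ⨆ i, |(of p N).symm f i|
    else ((1 / N : ℝ) * ∑ i, |(of p N).symm f i| ^ p.toReal) ^ (1 / p.toReal) := rfl

/-- The normalized norm is a multiple of the norm of `PiLp`. -/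
theorem norm_eq_smul [hp : Fact (1 ≤ p)] (f : LpN p N) :
    ‖f‖ = (if p = ∞ then 1 else (1 / N : ℝ) ^ (1 / p.toReal)) *
      ‖(WithLp.toLp p ((of p N).symm f) : PiLp p fun _ : Fin N => ℝ)‖ := by
  rw [norm_def]
  by_cases h : p = ∞
  · subst h
    simp [PiLp.norm_eq_ciSup]
  · have h0 : 0 < p.toReal := ENNReal.toReal_pos (zero_lt_one.trans_le hp.out).ne' h
    rw [if_neg h, if_neg h, PiLp.norm_eq_sum h0, Real.mul_rpow (by positivity)
      (Finset.sum_nonneg fun i _ => by positivity)]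
    simp [Real.norm_eq_abs]

theorem coeff_nonneg : (0 : ℝ) ≤ if p = ∞ then 1 else (1 / N : ℝ) ^ (1 / p.toReal) := by
  split_ifs <;> positivity

instance [hp : Fact (1 ≤ p)] : NormedAddCommGroup (LpN p N) :=
  AddGroupNorm.toNormedAddCommGroup
    { toFun := fun f => ‖f‖
      map_zero' := by rw [norm_eq_smul]; simp
      add_le' := fun f g => by
        rw [norm_eq_smul, norm_eq_smul, norm_eq_smul, ← mul_add]
        refine mul_le_mul_of_nonneg_left ?_ coeff_nonneg
        rw [map_add, WithLp.toLp_add]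
        exact norm_add_le _ _
      neg' := fun f => by
        rw [norm_eq_smul, norm_eq_smul, map_neg, WithLp.toLp_neg, norm_neg]
      eq_zero_of_map_eq_zero' := fun f hf => by
        rcases Nat.eq_zero_or_pos N with rfl | hN
        · exact (of p 0).symm.injective (Subsingleton.elim _ _)
        · rw [norm_eq_smul, mul_eq_zero] at hf
          have hc : (if p = ∞ then 1 else (1 / N : ℝ) ^ (1 / p.toReal)) ≠ 0 := by
            split_ifs <;> positivity
          have h := norm_eq_zero.1 (hf.resolve_left hc)
          refine (of p N).symm.injective ?_
          rw [map_zero]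
          exact WithLp.toLp_injective p (h.trans (WithLp.toLp_zero p).symm) }

instance [hp : Fact (1 ≤ p)] : NormedSpace ℝ (LpN p N) where
  norm_smul_le c f := by
    rw [norm_eq_smul, norm_eq_smul, map_smul, WithLp.toLp_smul, norm_smul]
    exact le_of_eq (by ring)

variable (p N) in
/-- The unit ball `B(L_p^N)`, as a set of functions. -/
def unitBall : Set (Fin N → ℝ) := {f | ‖of p N f‖ ≤ 1}

/-- The embedding `J_{pq}^N : L_p^N → L_q^N`, `f ↦ f`. -/
def embed (p q : ℝ≥0∞) (N : ℕ) : LpN p N →ₗ[ℝ] LpN q N :=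
  (of q N).toLinearMap ∘ₗ (of p N).symm.toLinearMap

end LpN

/-- The `n`-th minimal query error `e_n^q(J_{pq}^N, B(L_p^N))`. -/
def embedError (p q : ℝ≥0∞) [Fact (1 ≤ q)] (n N : ℕ) : ℝ≥0∞ :=
  minError n (fun f : LpN.unitBall p N => LpN.embed p q N (LpN.of p N f))

/-- `a(n, N) ≍_log b(n, N)`: two-sided bounds for `n₀ ≤ n ≤ c₀ N`, up to constants and powers of
`log₂ (N + n)`. -/
def AsympLog (a : ℕ → ℕ → ℝ≥0∞) (b : ℕ → ℕ → ℝ) : Prop :=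
  ∃ (c₀ c₁ c₂ : ℝ) (n₀ : ℕ) (α₁ α₂ : ℝ), 0 < c₀ ∧ 0 < c₁ ∧ 0 < c₂ ∧ 1 ≤ n₀ ∧
    ∀ n N : ℕ, 1 ≤ n → 1 ≤ N → n₀ ≤ n → (n : ℝ) ≤ c₀ * N →
      ENNReal.ofReal (c₁ * Real.logb 2 (N + n) ^ α₁ * b n N) ≤ a n N ∧
      a n N ≤ ENNReal.ofReal (c₂ * Real.logb 2 (N + n) ^ α₂ * b n N)

end QuantumApprox

end

/-! Lower bounds. Take inputs with `k` spikes of height `h = (N/k)^(1/p)`, one in each of `k` blocks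
of length `B`, and `0` elsewhere. They lie in the unit ball, and an output with error below `(1/8)
(N/k)^(1/p-1/q)` in `L_q^N` reveals all but few of the spikes. So everything rests on
`le_queries_of_blocks`: finding most spikes takes at least a constant times `k √B` queries. That is
a weighted adversary argument. Consider the sum of the inner products of the states over pairs of
inputs that differ by resetting one block. One query changes it by at most `2 √B` per input
(`query_step`, `blockAdversary`), and the changes add up over the measured parts, because earlier
results only contribute scalar amplitudes (`adaptive_step`). Success with probability `3/4`, on the
other hand, forces the final amplitudes apart on average. For `p < q` one takes `k` of order
`n^2/N`, but at least `1`, and `B` of order `N/k`, so that `k √B` is of order `√(kN)`, a large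
enough multiple of `n`. For `p ≥ q` blocks of length `16` suffice (`le_embedError_of_lt`,
`le_embedError_of_le`).

Upper bounds. The output `0` has error at most `1` if `p ≥ q` and at most `N^(1/p-1/q)` if `p < q`.
For `p < q` and larger `n`, put `t = (N/K)^(1/p)`; at most `K` values of `f` reach `t` in modulus.
Order `K log N` Grover runs, each with order `√(N/K)` queries, find them all with probability `3/4`
(`embedError_le_of_search`). The number of large values is unknown, so `K` dummy marked indices are
added: the number of marked indices then lies between `K` and `2K`, and one fixed number of
iterations suits all inputs. The remaining error is bounded by `t` and by `|f|`, hence by `t^(1-p/q)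
= (N/K)^(1/p-1/q)` in `L_q^N`. The total cost is of order `√(NK) log N`, so `K` of order `n^2/(N
log^2 N)` matches the lower bound up to logarithms. -/

noncomputable section

namespace QuantumApprox

/-! ### Queries as permutations -/

namespace Query

variable {D K : Type*} (Q : Query D K)

open Classical in
/-- The point of `D` at which the query reads the input on the basis vector `z`, if any. -/
def loc (z : Fin (2 ^ Q.m)) : Option D :=
  if h : (Q.split z).1 ∈ Q.Z then some (Q.τ ⟨(Q.split z).1, h⟩) else none

theorem split_act_fst (f : D → K) (z : Fin (2 ^ Q.m)) :
    (Q.split (Q.act f z)).1 = (Q.split z).1 := by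
  unfold act
  split_ifs <;> simp

theorem loc_act (f : D → K) (z : Fin (2 ^ Q.m)) : Q.loc (Q.act f z) = Q.loc z := by
  classical
  exact congrArg (fun i => if h : i ∈ Q.Z then some (Q.τ ⟨i, h⟩) else none) (Q.split_act_fst f z)

theorem act_injective (f : D → K) : Function.Injective (Q.act f) := by
  intro z w h
  have h1 : (Q.split z).1 = (Q.split w).1 := by
    rw [← Q.split_act_fst f z, h, Q.split_act_fst]
  unfold act at h
  by_cases hz : (Q.split z).1 ∈ Q.Z
  · have hw : (Q.split w).1 ∈ Q.Z := h1 ▸ hz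
    rw [dif_pos hz, dif_pos hw] at h
    have h2 := Q.split.symm.injective h
    simp only [Prod.mk.injEq] at h2
    obtain ⟨-, h3, h4⟩ := h2
    have h5 : (⟨(Q.split z).1, hz⟩ : Q.Z) = ⟨(Q.split w).1, hw⟩ := Subtype.ext h1
    rw [h5] at h3
    apply Q.split.injective
    exact Prod.ext h1 (Prod.ext (add_right_cancel h3) h4)
  · have hw : (Q.split w).1 ∉ Q.Z := h1 ▸ hz
    rwa [dif_neg hz, dif_neg hw] at h

/-- The action of `Q_f` on basis vectors, as a permutation. -/
def perm (f : D → K) : Equiv.Perm (Fin (2 ^ Q.m)) :=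
  Equiv.ofBijective (Q.act f) (Finite.injective_iff_bijective.1 (Q.act_injective f))

theorem perm_apply (f : D → K) (z : Fin (2 ^ Q.m)) : Q.perm f z = Q.act f z := rfl

theorem loc_perm_symm (f : D → K) (z : Fin (2 ^ Q.m)) :
    Q.loc ((Q.perm f).symm z) = Q.loc z := by
  conv_rhs => rw [← (Q.perm f).apply_symm_apply z]
  rw [perm_apply, loc_act]

theorem act_congr {f f' : D → K} {z : Fin (2 ^ Q.m)}
    (h : ∀ d, Q.loc z = some d → f d = f' d) : Q.act f z = Q.act f' z := by
  unfold act
  split_ifs with hz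
  · rw [h _ (by rw [loc, dif_pos hz])]
  · rfl

theorem mat_mulVec (f : D → K) (v : Fin (2 ^ Q.m) → ℂ) (z : Fin (2 ^ Q.m)) :
    (Q.mat f).mulVec v z = v ((Q.perm f).symm z) := by
  simp only [Matrix.mulVec, dotProduct, mat, Matrix.of_apply, ite_mul, one_mul, zero_mul]
  rw [Finset.sum_eq_single ((Q.perm f).symm z)]
  · rw [if_pos]
    rw [← perm_apply, Equiv.apply_symm_apply]
  · intro y _ hy
    rw [if_neg]
    rintro rfl
    exact hy ((Q.perm f).symm_apply_apply y).symm
  · simp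

theorem mat_mulVec_act (f : D → K) (v : Fin (2 ^ Q.m) → ℂ) (z : Fin (2 ^ Q.m)) :
    (Q.mat f).mulVec v (Q.act f z) = v z := by
  rw [mat_mulVec, ← perm_apply, Equiv.symm_apply_apply]

/-- Both permutations are moved to one side. The composite fixes every basis vector that reads a
point where `f` and `f'` agree, so only the other basis vectors can change an inner product. -/
theorem mat_dotProduct (f f' : D → K) (u v : Fin (2 ^ Q.m) → ℂ) :
    star ((Q.mat f).mulVec u) ⬝ᵥ (Q.mat f').mulVec v =
      ∑ z, star (u z) * v ((Q.perm f').symm (Q.perm f z)) := by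
  simp only [dotProduct, Pi.star_apply, mat_mulVec]
  rw [← Equiv.sum_comp (Q.perm f)]
  simp

theorem mat_dotProduct_self (f : D → K) (u v : Fin (2 ^ Q.m) → ℂ) :
    star ((Q.mat f).mulVec u) ⬝ᵥ (Q.mat f).mulVec v = star u ⬝ᵥ v := by
  rw [mat_dotProduct]
  simp [dotProduct]

/-- One query changes the inner product of two states only through the basis vectors that read
points at which the two inputs differ. -/
theorem norm_dotProduct_sub_le (f f' : D → K) (u v : Fin (2 ^ Q.m) → ℂ) (l l' : D → ℝ)
    (hl : ∀ d, 0 ≤ l d) (hl' : ∀ d, 0 ≤ l' d) (h : ∀ d, f d ≠ f' d → 1 ≤ l d * l' d)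
    [DecidableEq K] :
    ‖star u ⬝ᵥ v - star ((Q.mat f).mulVec u) ⬝ᵥ (Q.mat f').mulVec v‖ ≤
      ∑ z, (Q.loc z).elim 0 (fun d => if f d ≠ f' d then
        l d * ‖u z‖ ^ 2 + l' d * ‖v z‖ ^ 2 else 0) := by
  set ρ : Equiv.Perm (Fin (2 ^ Q.m)) := (Q.perm f).trans (Q.perm f').symm with hρ
  have hloc : ∀ z, Q.loc (ρ z) = Q.loc z := fun z => by
    simp [hρ, loc_perm_symm, perm_apply, loc_act]
  have hre : ∑ z, (Q.loc z).elim 0 (fun d => if f d ≠ f' d then l' d * ‖v (ρ z)‖ ^ 2 else 0) =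
      ∑ z, (Q.loc z).elim 0 (fun d => if f d ≠ f' d then l' d * ‖v z‖ ^ 2 else 0) := by
    rw [← Equiv.sum_comp ρ
      (fun z => (Q.loc z).elim 0 (fun d => if f d ≠ f' d then l' d * ‖v z‖ ^ 2 else 0))]
    simp only [hloc]
  -- `ρ` preserves the point that is read, so `‖v z‖ ^ 2` may be averaged with `‖v (ρ z)‖ ^ 2` under
  -- the sum. After this the estimate holds term by term.
  have hkey : ∑ z, (Q.loc z).elim 0 (fun d => if f d ≠ f' d then
        l d * ‖u z‖ ^ 2 + l' d * ‖v z‖ ^ 2 else 0) =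
      ∑ z, (Q.loc z).elim 0 (fun d => if f d ≠ f' d then
        l d * ‖u z‖ ^ 2 + l' d * ((‖v z‖ ^ 2 + ‖v (ρ z)‖ ^ 2) / 2) else 0) := by
    have e1 : ∀ z, (Q.loc z).elim 0 (fun d => if f d ≠ f' d then
        l d * ‖u z‖ ^ 2 + l' d * ((‖v z‖ ^ 2 + ‖v (ρ z)‖ ^ 2) / 2) else 0) =
        (Q.loc z).elim 0 (fun d => if f d ≠ f' d then
        l d * ‖u z‖ ^ 2 + l' d * ‖v z‖ ^ 2 else 0) +
        ((Q.loc z).elim 0 (fun d => if f d ≠ f' d then l' d * ‖v (ρ z)‖ ^ 2 else 0) -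
        (Q.loc z).elim 0 (fun d => if f d ≠ f' d then l' d * ‖v z‖ ^ 2 else 0)) / 2 := by
      intro z
      rcases Q.loc z with _ | d
      · simp
      · simp only [Option.elim]
        split_ifs <;> ring
    simp only [e1]
    rw [Finset.sum_add_distrib, ← Finset.sum_div, Finset.sum_sub_distrib, hre]
    simp
  rw [hkey, mat_dotProduct, dotProduct, ← Finset.sum_sub_distrib]
  refine (norm_sum_le _ _).trans (Finset.sum_le_sum fun z _ => ?_)
  rw [Pi.star_apply, ← mul_sub, norm_mul, norm_star]
  have hfix : (∀ d, Q.loc z = some d → f d = f' d) → ρ z = z := fun hd => by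
    simp only [hρ, Equiv.trans_apply, perm_apply]
    rw [Q.act_congr hd, ← perm_apply, Equiv.symm_apply_apply]
  change ‖u z‖ * ‖v z - v (ρ z)‖ ≤ _
  rcases hz : Q.loc z with _ | d
  · rw [hfix (by simp [hz])]; simp
  · simp only [Option.elim]
    split_ifs with hd
    · have h1 := h d hd
      have h2 : ‖v z - v (ρ z)‖ ≤ ‖v z‖ + ‖v (ρ z)‖ := norm_sub_le _ _
      have h3 := norm_nonneg (u z)
      -- Weighted AM-GM, using `l d * l' d ≥ 1`.
      have key : ∀ x y : ℝ, 0 ≤ x → 0 ≤ y → x * y ≤ (l d * x ^ 2 + l' d * y ^ 2) / 2 := by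
        intro x y hx hy
        have h4 : (x * y) ^ 2 ≤ ((l d * x ^ 2 + l' d * y ^ 2) / 2) ^ 2 := by
          have : (x * y) ^ 2 ≤ (l d * l' d) * (x * y) ^ 2 := by
            nlinarith [sq_nonneg (x * y)]
          nlinarith [sq_nonneg (l d * x ^ 2 - l' d * y ^ 2)]
        have h5 : 0 ≤ (l d * x ^ 2 + l' d * y ^ 2) / 2 := by
          have := hl d
          have := hl' d
          positivity
        exact (sq_le_sq₀ (by positivity) h5).1 h4
      have h6 := key _ _ h3 (norm_nonneg (v z))
      have h7 := key _ _ h3 (norm_nonneg (v (ρ z)))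
      nlinarith
    · rw [hfix (by simpa [hz] using hd)]; simp

end Query

/-! ### The weighted adversary argument -/

theorem unitary_dotProduct {ι : Type*} [Fintype ι] [DecidableEq ι]
    (U : Matrix.unitaryGroup ι ℂ) (u v : ι → ℂ) :
    star ((U : Matrix ι ι ℂ).mulVec u) ⬝ᵥ (U : Matrix ι ι ℂ).mulVec v = star u ⬝ᵥ v := by
  rw [Matrix.star_mulVec, Matrix.dotProduct_mulVec, Matrix.vecMul_vecMul,
    ← Matrix.star_eq_conjTranspose, Matrix.mem_unitaryGroup_iff'.1 U.2, Matrix.vecMul_one]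

theorem star_dotProduct_self_eq {ι : Type*} [Fintype ι] (u : ι → ℂ) :
    star u ⬝ᵥ u = ((∑ x, ‖u x‖ ^ 2 : ℝ) : ℂ) := by
  simp only [dotProduct, Pi.star_apply, RCLike.star_def, Complex.conj_mul']
  push_cast
  rfl

section Adversary

variable {I D K : Type*} [Fintype I]

/-- Weights for the adversary argument with progress rate `κ`, on the inputs `F i`. -/
structure Adversary (F : I → D → K) (κ : ℝ) where
  W : I → I → ℝ
  W_nonneg : ∀ i j, 0 ≤ W i j
  W_symm : ∀ i j, W i j = W j i
  l : I → D → ℝ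
  l_nonneg : ∀ i d, 0 ≤ l i d
  one_le : ∀ i j d, F i d ≠ F j d → 1 ≤ l i d * l j d
  sum_le : ∀ i d, ∑ j, W i j * (open Classical in if F i d ≠ F j d then l i d else 0) ≤ κ

namespace Adversary

variable {F : I → D → K} {κ : ℝ} (Adv : Adversary F κ)

-- Basis vectors that read no point contribute nothing to the progress; `0 ≤ κ` allows charging them
-- `κ ‖v z‖ ^ 2` like the others.
include Adv in
theorem kappa_nonneg [Nonempty I] [Nonempty D] : 0 ≤ κ := by
  classical
  refine le_trans (Finset.sum_nonneg fun j _ => mul_nonneg (Adv.W_nonneg _ _) ?_)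
    (Adv.sum_le (Classical.arbitrary I) (Classical.arbitrary D))
  split_ifs
  exacts [Adv.l_nonneg _ _, le_rfl]

/-- The progress of one query. -/
theorem query_step (Q : Query D K) (v : I → Fin (2 ^ Q.m) → ℂ) :
    ‖∑ i, ∑ j, (Adv.W i j : ℂ) * (star (v i) ⬝ᵥ v j -
        star ((Q.mat (F i)).mulVec (v i)) ⬝ᵥ (Q.mat (F j)).mulVec (v j))‖ ≤
      2 * κ * ∑ i, ∑ z, ‖v i z‖ ^ 2 := by
  classical
  have hκ : ∀ [Nonempty I] [Nonempty D], 0 ≤ κ := Adv.kappa_nonneg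
  set T : I → I → Fin (2 ^ Q.m) → ℝ := fun i j z =>
    Adv.W i j * (Q.loc z).elim 0 (fun d => if F i d ≠ F j d then Adv.l i d * ‖v i z‖ ^ 2 else 0)
    with hT
  have h1 : ‖∑ i, ∑ j, (Adv.W i j : ℂ) * (star (v i) ⬝ᵥ v j -
        star ((Q.mat (F i)).mulVec (v i)) ⬝ᵥ (Q.mat (F j)).mulVec (v j))‖ ≤
      ∑ i, ∑ j, ∑ z, (T i j z + T j i z) := by
    refine (norm_sum_le _ _).trans (Finset.sum_le_sum fun i _ => ?_)
    refine (norm_sum_le _ _).trans (Finset.sum_le_sum fun j _ => ?_)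
    rw [norm_mul, Complex.norm_real, Real.norm_of_nonneg (Adv.W_nonneg i j)]
    refine (mul_le_mul_of_nonneg_left (Q.norm_dotProduct_sub_le (F i) (F j) (v i) (v j)
      (Adv.l i) (Adv.l j) (Adv.l_nonneg i) (Adv.l_nonneg j) (Adv.one_le i j))
      (Adv.W_nonneg i j)).trans (le_of_eq ?_)
    rw [Finset.mul_sum]
    refine Finset.sum_congr rfl fun z _ => ?_
    simp only [hT]
    rw [Adv.W_symm j i, ← mul_add]
    congr 1
    rcases Q.loc z with _ | d
    · simp
    · simp only [Option.elim, ne_comm (a := F j d)]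
      split_ifs <;> simp
  refine h1.trans ?_
  simp only [Finset.sum_add_distrib]
  -- Exchanging `i` and `j` shows that the two halves of the bound are equal, whence the factor `2`;
  -- what remains is the row condition `sum_le`.
  rw [Finset.sum_comm (f := fun i j => ∑ z, T j i z), ← two_mul, mul_assoc]
  refine mul_le_mul_of_nonneg_left ?_ zero_le_two
  rw [Finset.mul_sum]
  refine Finset.sum_le_sum fun i _ => ?_
  rw [Finset.sum_comm, Finset.mul_sum]
  refine Finset.sum_le_sum fun z _ => ?_
  simp only [hT]
  have : Nonempty I := ⟨i⟩
  rcases hz : Q.loc z with _ | d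
  · have : Nonempty D := by
      obtain ⟨a, ha⟩ := Q.Z_nonempty
      exact ⟨Q.τ ⟨a, ha⟩⟩
    simpa using mul_nonneg hκ (sq_nonneg _)
  · simp only [Option.elim]
    refine le_trans (le_of_eq ?_) (mul_le_mul_of_nonneg_right (Adv.sum_le i d) (sq_nonneg ‖v i z‖))
    rw [Finset.sum_mul]
    refine Finset.sum_congr rfl fun j _ => ?_
    split_ifs <;> simp [mul_assoc]

theorem alternate_dotProduct_self (Q : Query D K) (f : D → K) (n : ℕ)
    (U : Fin (n + 1) → Matrix.unitaryGroup (Fin (2 ^ Q.m)) ℂ) (u v : Fin (2 ^ Q.m) → ℂ) :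
    star ((alternate (Q.mat f) n (fun j => (U j : Matrix _ _ ℂ))).mulVec u) ⬝ᵥ
      (alternate (Q.mat f) n (fun j => (U j : Matrix _ _ ℂ))).mulVec v = star u ⬝ᵥ v := by
  induction n with
  | zero => exact unitary_dotProduct _ _ _
  | succ n ih =>
    simp only [alternate, ← Matrix.mulVec_mulVec]
    rw [unitary_dotProduct, Query.mat_dotProduct_self]
    exact ih _

theorem sum_norm_sq_alternate (Q : Query D K) (f : D → K) (n : ℕ)
    (U : Fin (n + 1) → Matrix.unitaryGroup (Fin (2 ^ Q.m)) ℂ) (v : Fin (2 ^ Q.m) → ℂ) :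
    ∑ z, ‖(alternate (Q.mat f) n (fun j => (U j : Matrix _ _ ℂ))).mulVec v z‖ ^ 2 =
      ∑ z, ‖v z‖ ^ 2 := by
  have h := alternate_dotProduct_self Q f n U v v
  rw [star_dotProduct_self_eq, star_dotProduct_self_eq] at h
  exact_mod_cast h

/-- The progress of an algorithm with no measurement. -/
theorem alternate_step (Q : Query D K) (n : ℕ)
    (U : Fin (n + 1) → Matrix.unitaryGroup (Fin (2 ^ Q.m)) ℂ) (v : I → Fin (2 ^ Q.m) → ℂ) :
    ‖∑ i, ∑ j, (Adv.W i j : ℂ) * (star (v i) ⬝ᵥ v j -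
        star ((alternate (Q.mat (F i)) n (fun j => (U j : Matrix _ _ ℂ))).mulVec (v i)) ⬝ᵥ
          (alternate (Q.mat (F j)) n (fun j => (U j : Matrix _ _ ℂ))).mulVec (v j))‖ ≤
      n * (2 * κ) * ∑ i, ∑ z, ‖v i z‖ ^ 2 := by
  induction n with
  | zero => simp [alternate, unitary_dotProduct]
  | succ n ih =>
    have h1 := ih (fun j => U j.castSucc)
    set w : I → Fin (2 ^ Q.m) → ℂ := fun i =>
      (alternate (Q.mat (F i)) n (fun j => (U j.castSucc : Matrix _ _ ℂ))).mulVec (v i) with hw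
    have h2 := Adv.query_step Q w
    have h3 : ∀ i, ∑ z, ‖w i z‖ ^ 2 = ∑ z, ‖v i z‖ ^ 2 := fun i =>
      sum_norm_sq_alternate Q (F i) n (fun j => U j.castSucc) (v i)
    simp only [h3] at h2
    have h4 : ∀ i, (alternate (Q.mat (F i)) (n + 1) (fun j => (U j : Matrix _ _ ℂ))).mulVec (v i) =
        (U (Fin.last (n + 1)) : Matrix _ _ ℂ).mulVec ((Q.mat (F i)).mulVec (w i)) := fun i => by
      simp only [alternate, ← Matrix.mulVec_mulVec, hw]
    simp only [h4, unitary_dotProduct]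
    have h5 : ∑ i, ∑ j, (Adv.W i j : ℂ) * (star (v i) ⬝ᵥ v j -
        star ((Q.mat (F i)).mulVec (w i)) ⬝ᵥ (Q.mat (F j)).mulVec (w j)) =
        ∑ i, ∑ j, (Adv.W i j : ℂ) * (star (v i) ⬝ᵥ v j - star (w i) ⬝ᵥ w j) +
        ∑ i, ∑ j, (Adv.W i j : ℂ) * (star (w i) ⬝ᵥ w j -
        star ((Q.mat (F i)).mulVec (w i)) ⬝ᵥ (Q.mat (F j)).mulVec (w j)) := by
      simp only [← Finset.sum_add_distrib, ← mul_add]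
      simp
    rw [h5]
    refine (norm_add_le _ _).trans ((add_le_add h1 h2).trans (le_of_eq ?_))
    push_cast
    ring

theorem alternate_single (Q : Query D K) (f : D → K) (n : ℕ)
    (U : Fin (n + 1) → Matrix.unitaryGroup (Fin (2 ^ Q.m)) ℂ) (y : Fin (2 ^ Q.m)) (c : ℂ) :
    (alternate (Q.mat f) n (fun j => (U j : Matrix _ _ ℂ))).mulVec (Pi.single y c) =
      fun x => c * alternate (Q.mat f) n (fun j => (U j : Matrix _ _ ℂ)) x y := by
  ext x
  rw [Matrix.mulVec_single]
  simp [mul_comm]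

theorem sum_norm_sq_single {ι : Type*} [Fintype ι] [DecidableEq ι] (y : ι) (c : ℂ) :
    ∑ z, ‖(Pi.single y c : ι → ℂ) z‖ ^ 2 = ‖c‖ ^ 2 := by
  rw [Finset.sum_eq_single y]
  · simp
  · intro z _ hz
    simp [Pi.single_eq_of_ne hz]
  · simp

/-- The scalars `a i` stand for the amplitudes accumulated in earlier measurements. Allowing them
makes the bound composable over the parts. -/
theorem pure_step (A : PureAlgorithm D K) (y : Fin (2 ^ A.m)) (a : I → ℂ) :
    ‖∑ i, ∑ j, (Adv.W i j : ℂ) * (star (a i) * a j -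
        ∑ x, star (a i * A.mat (F i) x y) * (a j * A.mat (F j) x y))‖ ≤
      A.n * (2 * κ) * ∑ i, ‖a i‖ ^ 2 := by
  have key : ∀ y : Fin (2 ^ A.Q.m), _ := fun y =>
    Adv.alternate_step A.Q A.n A.U (fun i => Pi.single y (a i))
  have h3 : ∀ (y : Fin (2 ^ A.Q.m)) i j,
      star (Pi.single y (a i) : Fin (2 ^ A.Q.m) → ℂ) ⬝ᵥ Pi.single y (a j) =
      star (a i) * a j := by
    intro y i j
    rw [dotProduct_single]
    simp
  simp only [alternate_single, sum_norm_sq_single, h3] at key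
  exact key y

end Adversary

theorem PureAlgorithm.sum_norm_sq (A : PureAlgorithm D K) (f : D → K) (y : Fin (2 ^ A.m)) :
    ∑ x, ‖A.mat f x y‖ ^ 2 = 1 := by
  have key : ∀ y : Fin (2 ^ A.Q.m), _ := fun y =>
    Adversary.sum_norm_sq_alternate A.Q f A.n A.U (Pi.single y 1)
  simp only [Adversary.alternate_single, Adversary.sum_norm_sq_single, one_mul, norm_one,
    one_pow] at key
  exact key y

end Adversary

/-! ### Sequences of measurements -/

/-- The product of the entries `M l (x l) (b l (x_0, …, x_{l-1}))`. -/
def ampl {k : ℕ} {X : Fin k → Type} (M : ∀ l, X l → X l → ℂ)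
    (b : (l : Fin k) → ((i : Fin k) → i < l → X i) → X l) (x : ∀ l, X l) : ℂ :=
  ∏ l, M l (x l) (b l fun i _ => x i)

/-- The start indices of the parts after the first one, given the first result. -/
def tailStart {k : ℕ} {X : Fin (k + 1) → Type}
    (b : (l : Fin (k + 1)) → ((i : Fin (k + 1)) → i < l → X i) → X l) (x₀ : X 0) (l : Fin k)
    (h : (i : Fin k) → i < l → X i.succ) : X l.succ :=
  b l.succ fun i => Fin.cases (motive := fun i => i < l.succ → X i) (fun _ => x₀)
    (fun i hi => h i (Fin.succ_lt_succ_iff.1 hi)) i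

/-- This lets inductions peel off the first measurement: its result becomes a parameter in the start
indices of the remaining parts. -/
theorem ampl_cons {k : ℕ} {X : Fin (k + 1) → Type} (M : ∀ l, X l → X l → ℂ)
    (b : (l : Fin (k + 1)) → ((i : Fin (k + 1)) → i < l → X i) → X l) (x₀ : X 0)
    (x : ∀ l : Fin k, X l.succ) :
    ampl M b (Fin.cons x₀ x) =
      M 0 x₀ (b 0 fun i h => absurd h (Fin.not_lt_zero i)) *
        ampl (X := fun l => X l.succ) (fun l => M l.succ) (tailStart b x₀) x := by
  unfold ampl
  rw [Fin.prod_univ_succ]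
  congr 1
  · rw [Fin.cons_zero]
    congr 2
    funext i h
    exact absurd h (Fin.not_lt_zero i)
  · refine Finset.prod_congr rfl fun l _ => ?_
    rw [Fin.cons_succ]
    congr 1
    unfold tailStart
    congr 1
    funext i h
    induction i using Fin.cases with
    | zero => rfl
    | succ i => rfl

theorem sum_pi_succ {k : ℕ} {X : Fin (k + 1) → Type} [∀ l, Fintype (X l)] {R : Type*}
    [AddCommMonoid R] (g : (∀ l, X l) → R) :
    ∑ x, g x = ∑ x₀ : X 0, ∑ x : ∀ l : Fin k, X l.succ, g (Fin.cons x₀ x) := by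
  rw [← Equiv.sum_comp (Fin.consEquiv X), Fintype.sum_prod_type]
  rfl

theorem sum_norm_sq_ampl {k : ℕ} {X : Fin k → Type} [∀ l, Fintype (X l)]
    (M : ∀ l, X l → X l → ℂ) (hM : ∀ l y, ∑ x, ‖M l x y‖ ^ 2 = 1)
    (b : (l : Fin k) → ((i : Fin k) → i < l → X i) → X l) :
    ∑ x, ‖ampl M b x‖ ^ 2 = 1 := by
  induction k with
  | zero => simp [ampl]
  | succ k ih =>
    rw [sum_pi_succ]
    simp only [ampl_cons, norm_mul, mul_pow, ← Finset.mul_sum]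
    simp only [ih (fun l => M l.succ) (fun l => hM l.succ), mul_one]
    exact hM 0 _

/-- The change of the weighted inner products is additive over the measured parts. -/
theorem adaptive_step {I : Type*} [Fintype I] (W : I → I → ℝ) {k : ℕ} {X : Fin k → Type}
    [∀ l, Fintype (X l)] (M : I → ∀ l, X l → X l → ℂ)
    (hM : ∀ i l y, ∑ x, ‖M i l x y‖ ^ 2 = 1) (c : Fin k → ℝ)
    (hc : ∀ l y (a : I → ℂ), ‖∑ i, ∑ j, (W i j : ℂ) * (star (a i) * a j -
        ∑ x, star (a i * M i l x y) * (a j * M j l x y))‖ ≤ c l * ∑ i, ‖a i‖ ^ 2)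
    (b : (l : Fin k) → ((i : Fin k) → i < l → X i) → X l) (a : I → ℂ) :
    ‖∑ i, ∑ j, (W i j : ℂ) * (star (a i) * a j -
        ∑ x, star (a i * ampl (M i) b x) * (a j * ampl (M j) b x))‖ ≤
      (∑ l, c l) * ∑ i, ‖a i‖ ^ 2 := by
  induction k generalizing a with
  | zero => simp [ampl]
  | succ k ih =>
    set b₀ : X 0 := b 0 fun i h => absurd h (Fin.not_lt_zero i) with hb₀
    have h0 := hc 0 b₀ a
    have h1 : ∀ x₀ : X 0, _ := fun x₀ =>
      ih (fun i l => M i l.succ) (fun i l => hM i l.succ) (fun l => c l.succ)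
        (fun l => hc l.succ) (tailStart b x₀) (fun i => a i * M i 0 x₀ b₀)
    -- Telescoping: the inner products after the first measurement are inserted. For each result
    -- `x₀` the rest is a shorter algorithm with scalars `a i * M i 0 x₀ b₀`.
    have h2 : ∑ i, ∑ j, (W i j : ℂ) * (star (a i) * a j -
        ∑ x, star (a i * ampl (M i) b x) * (a j * ampl (M j) b x)) =
      ∑ i, ∑ j, (W i j : ℂ) * (star (a i) * a j -
        ∑ x, star (a i * M i 0 x b₀) * (a j * M j 0 x b₀)) +
      ∑ x₀, ∑ i, ∑ j, (W i j : ℂ) * (star (a i * M i 0 x₀ b₀) * (a j * M j 0 x₀ b₀) -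
        ∑ x, star (a i * M i 0 x₀ b₀ *
            ampl (X := fun l => X l.succ) (fun l => M i l.succ) (tailStart b x₀) x) *
          (a j * M j 0 x₀ b₀ *
            ampl (X := fun l => X l.succ) (fun l => M j l.succ) (tailStart b x₀) x)) := by
      conv_rhs => enter [2]; rw [Finset.sum_comm]
      rw [← Finset.sum_add_distrib]
      refine Finset.sum_congr rfl fun i _ => ?_
      conv_rhs => enter [2]; rw [Finset.sum_comm]
      rw [← Finset.sum_add_distrib]
      refine Finset.sum_congr rfl fun j _ => ?_
      rw [← Finset.mul_sum, ← mul_add, Finset.sum_sub_distrib, sum_pi_succ]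
      simp only [ampl_cons, ← hb₀, mul_assoc]
      ring
    rw [h2]
    refine (norm_add_le _ _).trans ?_
    refine (add_le_add h0 ((norm_sum_le _ _).trans (Finset.sum_le_sum fun x₀ _ => h1 x₀))).trans
      (le_of_eq ?_)
    -- The columns of `M i 0` are unit vectors, so the squared moduli of the new scalars, summed
    -- over `x₀`, give back `∑ ‖a i‖ ^ 2`; the constants `c l` simply add.
    rw [← Finset.mul_sum, Finset.sum_comm, Fin.sum_univ_succ, add_mul]
    congr 2
    refine Finset.sum_congr rfl fun i _ => ?_
    simp only [norm_mul, mul_pow, ← Finset.mul_sum, hM, mul_one]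

/-! ### Amplitudes and output probabilities of algorithms with measurements. -/

namespace Algorithm

variable {D K G : Type*} (A : Algorithm D K G)

/-- The amplitude of the measurement results `x_0, …, x_{k-1}`. -/
def amp (f : D → K) (x : (l : Fin A.k) → Fin (2 ^ (A.A l).m)) : ℂ :=
  ampl (fun l => (A.A l).mat f) A.b x

theorem resultProb_eq (f : D → K) (x : (l : Fin A.k) → Fin (2 ^ (A.A l).m)) :
    A.resultProb f x = ‖A.amp f x‖ ^ 2 := by
  unfold amp ampl
  rw [norm_prod, ← Finset.prod_pow]
  rfl

theorem resultProb_nonneg (f : D → K) (x : (l : Fin A.k) → Fin (2 ^ (A.A l).m)) :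
    0 ≤ A.resultProb f x := by
  rw [resultProb_eq]; positivity

theorem sum_resultProb (f : D → K) : ∑ x, A.resultProb f x = 1 := by
  simp only [resultProb_eq]
  exact sum_norm_sq_ampl _ (fun l y => (A.A l).sum_norm_sq f y) _

theorem outputProb_mono (f : D → K) {C C' : Set G} (h : C ⊆ C') :
    A.outputProb f C ≤ A.outputProb f C' := by
  classical
  refine Finset.sum_le_sum fun x _ => ?_
  have := A.resultProb_nonneg f x
  split_ifs with h1 h2
  · rfl
  · exact absurd (h h1) h2
  · exact this
  · rfl

/-- The outputs of an algorithm at two inputs are as close as the amplitudes. -/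
theorem outputProb_sub_le (f f' : D → K) (C : Set G) :
    A.outputProb f C - A.outputProb f' C ≤
      16 * (1 - (∑ x, star (A.amp f x) * A.amp f' x).re) + 1 / 8 := by
  classical
  -- The difference is at most `|u-v| |u+v| ≤ 8 |u-v|^2 + |u+v|^2 / 32`, and `|u+v|^2 ≤ 2 (|u|^2 +
  -- |v|^2)`. The second claim serves the results whose output lies outside `C`.
  have h1 : ∀ u v : ℂ, ‖u‖ ^ 2 - ‖v‖ ^ 2 ≤
      8 * (‖u‖ ^ 2 + ‖v‖ ^ 2 - 2 * (star u * v).re) + (‖u‖ ^ 2 + ‖v‖ ^ 2) / 16 ∧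
      0 ≤ 8 * (‖u‖ ^ 2 + ‖v‖ ^ 2 - 2 * (star u * v).re) + (‖u‖ ^ 2 + ‖v‖ ^ 2) / 16 := by
    intro u v
    simp only [← Complex.normSq_eq_norm_sq, Complex.normSq_apply]
    simp only [RCLike.star_def, Complex.mul_re, Complex.conj_re, Complex.conj_im]
    constructor
    · nlinarith [sq_nonneg (8 * (u.re - v.re) - (u.re + v.re) / 2),
        sq_nonneg (8 * (u.im - v.im) - (u.im + v.im) / 2), sq_nonneg (u.re - v.re),
        sq_nonneg (u.im - v.im)]
    · nlinarith [sq_nonneg (u.re - v.re), sq_nonneg (u.im - v.im), sq_nonneg u.re,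
        sq_nonneg v.re, sq_nonneg u.im, sq_nonneg v.im]
  have h2 : A.outputProb f C - A.outputProb f' C ≤
      ∑ x, (8 * (‖A.amp f x‖ ^ 2 + ‖A.amp f' x‖ ^ 2 - 2 * (star (A.amp f x) * A.amp f' x).re) +
        (‖A.amp f x‖ ^ 2 + ‖A.amp f' x‖ ^ 2) / 16) := by
    unfold outputProb
    rw [← Finset.sum_sub_distrib]
    refine Finset.sum_le_sum fun x _ => ?_
    obtain ⟨h3, h4⟩ := h1 (A.amp f x) (A.amp f' x)
    split_ifs
    · simpa only [resultProb_eq] using h3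
    · simpa using h4
  refine h2.trans (le_of_eq ?_)
  have e1 := A.sum_resultProb f
  have e2 := A.sum_resultProb f'
  simp only [resultProb_eq] at e1 e2
  rw [Finset.sum_add_distrib, ← Finset.sum_div, ← Finset.mul_sum, Finset.sum_sub_distrib,
    Finset.sum_add_distrib, e1, e2, ← Finset.mul_sum, ← Complex.re_sum]
  ring

/-- The total progress of an algorithm with measurements. -/
theorem adversary_le {I : Type*} [Fintype I] {F : I → D → K} {κ : ℝ} (Adv : Adversary F κ) :
    ∑ i, ∑ j, Adv.W i j * (1 - (∑ x, star (A.amp (F i) x) * A.amp (F j) x).re) ≤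
      A.queries * (2 * κ) * Fintype.card I := by
  have h := adaptive_step Adv.W (fun i l => (A.A l).mat (F i))
    (fun i l y => (A.A l).sum_norm_sq (F i) y) (fun l => (A.A l).n * (2 * κ))
    (fun l y a => Adv.pure_step (A.A l) y a) A.b (fun _ => 1)
  have h1 : ∑ i : I, ‖(1 : ℂ)‖ ^ 2 = Fintype.card I := by simp
  rw [h1, ← Finset.sum_mul] at h
  have h2 : ((∑ l, ((A.A l).n : ℝ)) : ℝ) = A.queries := by simp [queries]
  rw [h2] at h
  refine le_trans (le_of_eq ?_) ((Complex.re_le_norm _).trans h)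
  simp only [Complex.re_sum, Complex.re_ofReal_mul, Complex.sub_re, star_one, one_mul,
    Complex.one_re]
  rfl

end Algorithm

/-! ### Inputs with one marked point per block -/

section Blocks

variable {D K : Type*} {k B : ℕ} (pos : D → Option (Fin k × Fin B)) (v₀ v₁ : K)

/-- The point `d` is the one that `σ` marks in its block. -/
def Marked (σ : Fin k → Fin B) (d : D) : Prop := ∃ b, pos d = some (b, σ b)

open Classical in
/-- The input with value `v₁` at the marked points and `v₀` elsewhere. -/
def blockInput (σ : Fin k → Fin B) (d : D) : K := if Marked pos σ d then v₁ else v₀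

/-- The number of ways to obtain `σ'` from `σ` by resetting one block. -/
def blockWeight (σ σ' : Fin k → Fin B) : ℝ :=
  ∑ b, ∑ i, if σ' = Function.update σ b i then 1 else 0

/-- A reset of block `b` leads from `σ` to `σ'` exactly when they agree off `b`, which is a
symmetric condition. -/
theorem blockWeight_comm (σ σ' : Fin k → Fin B) : blockWeight σ σ' = blockWeight σ' σ := by
  have h : ∀ (σ σ' : Fin k → Fin B) b,
      (∑ i, if σ' = Function.update σ b i then (1 : ℝ) else 0) =
        if ∀ a, a ≠ b → σ' a = σ a then 1 else 0 := by
    intro σ σ' b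
    simp only [Function.eq_update_iff, ite_and]
    rw [Finset.sum_ite_eq]
    simp
  unfold blockWeight
  simp only [h]
  refine Finset.sum_congr rfl fun b _ => ?_
  simp only [eq_comm]

theorem sum_blockWeight_mul (σ : Fin k → Fin B) (g : (Fin k → Fin B) → ℝ) :
    ∑ σ', blockWeight σ σ' * g σ' = ∑ b, ∑ i, g (Function.update σ b i) := by
  simp only [blockWeight, Finset.sum_mul, ite_mul, one_mul, zero_mul]
  rw [Finset.sum_comm]
  refine Finset.sum_congr rfl fun b _ => ?_
  rw [Finset.sum_comm]
  simp

/-- Swapping the mark `σ b` with the new position `i` is an involution on the pairs `(σ, i)`. -/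
theorem sum_update {R : Type*} [AddCommMonoid R] (b : Fin k)
    (g : (Fin k → Fin B) → Fin B → R) :
    ∑ σ, ∑ i, g (Function.update σ b i) (σ b) = ∑ σ, ∑ i, g σ i := by
  let e : (Fin k → Fin B) × Fin B ≃ (Fin k → Fin B) × Fin B :=
    { toFun := fun x => (Function.update x.1 b x.2, x.1 b)
      invFun := fun x => (Function.update x.1 b x.2, x.1 b)
      left_inv := fun x => by simp
      right_inv := fun x => by simp }
  have h := Equiv.sum_comp e (fun x => g x.1 x.2)
  rw [Fintype.sum_prod_type, Fintype.sum_prod_type] at h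
  exact h

theorem marked_of_ne {σ σ' : Fin k → Fin B} {d : D}
    (h : blockInput pos v₀ v₁ σ d ≠ blockInput pos v₀ v₁ σ' d) :
    ¬ (Marked pos σ d ↔ Marked pos σ' d) := by
  intro h1
  classical
  exact h (if_congr h1 rfl rfl)

open Classical in
/-- The adversary for inputs with one marked point in each of `k` blocks of length `B`. -/
def blockAdversary (hB : 1 ≤ B) : Adversary (blockInput pos v₀ v₁) (√(B : ℝ)) where
  W := blockWeight
  W_nonneg σ σ' := Finset.sum_nonneg fun b _ => Finset.sum_nonneg fun i _ => by
    split_ifs <;> norm_num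
  W_symm := blockWeight_comm
  -- If `σ` marks `d`, up to `B` resets change the value at `d`; otherwise at most the one reset
  -- that moves the mark to `d` does. These factors balance both cases at `√B`.
  l σ d := if Marked pos σ d then (√(B : ℝ))⁻¹ else √(B : ℝ)
  l_nonneg σ d := by split_ifs <;> positivity
  one_le σ σ' d h := by
    have h1 := marked_of_ne pos v₀ v₁ h
    have hs : √(B : ℝ) ≠ 0 := (Real.sqrt_pos.2 (by exact_mod_cast hB)).ne'
    by_cases h2 : Marked pos σ d <;> by_cases h3 : Marked pos σ' d <;>
      simp_all
  sum_le σ d := by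
    have hs : 0 < √(B : ℝ) := Real.sqrt_pos.2 (by exact_mod_cast hB)
    rw [sum_blockWeight_mul]
    rcases hd : pos d with _ | ⟨b₀, j⟩
    · refine le_trans (le_of_eq ?_) hs.le
      refine Finset.sum_eq_zero fun b _ => Finset.sum_eq_zero fun i _ => ?_
      simp [blockInput, Marked, hd]
    · have hm : ∀ τ : Fin k → Fin B, Marked pos τ d ↔ τ b₀ = j := by
        intro τ
        unfold Marked
        rw [hd]
        constructor
        · rintro ⟨b, hb⟩
          simp only [Option.some.injEq, Prod.mk.injEq] at hb
          obtain ⟨rfl, rfl⟩ := hb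
          rfl
        · rintro rfl
          exact ⟨b₀, rfl⟩
      rw [Finset.sum_eq_single b₀]
      · by_cases h : σ b₀ = j
        · refine (Finset.sum_le_card_nsmul _ _ (√(B : ℝ))⁻¹ fun i _ => ?_).trans (le_of_eq ?_)
          · rw [if_pos ((hm σ).2 h)]
            split_ifs
            · rfl
            · positivity
          · rw [Finset.card_univ, Fintype.card_fin, nsmul_eq_mul, ← div_eq_mul_inv,
              Real.div_sqrt]
        · rw [Finset.sum_eq_single j]
          · rw [if_neg (mt (hm σ).1 h)]
            split_ifs
            · rfl
            · exact hs.le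
          · intro i _ hi
            rw [if_neg]
            rw [not_not]
            simp [blockInput, hm, h, hi]
          · simp
      · intro b _ hb
        refine Finset.sum_eq_zero fun i _ => ?_
        rw [if_neg]
        rw [not_not]
        simp [blockInput, hm, Function.update_of_ne hb.symm]
      · simp

open Classical in
/-- An algorithm that finds most of the marked points of all block inputs with probability `3/4`
needs many queries. -/
theorem le_queries_of_blocks {G : Type*} (A : Algorithm D K G) (hB : 16 ≤ B) (hk : 1 ≤ k)
    (C : Fin k → Fin B → Set G) (bad : (Fin k → Fin B) → Set G)
    (hbad : ∀ σ, A.outputProb (blockInput pos v₀ v₁ σ) (bad σ) ≤ 1 / 4)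
    (hgood : ∀ σ, ∀ g ∉ bad σ,
      ∑ b, ∑ j, (if (g ∈ C b j ↔ j = σ b) then 0 else 1 : ℝ) ≤ k / 4) :
    7 / 2048 * (k * √(B : ℝ)) ≤ A.queries := by
  have hB1 : 1 ≤ B := by omega
  have : NeZero B := ⟨by omega⟩
  set F := blockInput pos v₀ v₁ with hF
  have hone : ∀ σ : Fin k → Fin B, ∑ b, ∑ j, (if j = σ b then 1 else 0 : ℝ) = k := by
    intro σ
    simp
  have hind : ∀ (a b : Prop) [Decidable a] [Decidable b] [Decidable (a ↔ b)],
      (if a then 1 else 0 : ℝ) ≤ (if b then 1 else 0) + (if (a ↔ b) then 0 else 1) ∧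
      (if b then 1 else 0 : ℝ) - (if (a ↔ b) then 0 else 1) ≤
        if b then (if a then 1 else 0) else 0 := by
    intro a b _ _ _
    by_cases ha : a <;> by_cases hb : b <;> simp [ha, hb]
  -- With probability at least `3/4`, at least `3/4` of the marks are recognized.
  have h1 : ∀ σ, 9 / 16 * (k : ℝ) ≤ ∑ b, A.outputProb (F σ) (C b (σ b)) := by
    intro σ
    have e1 : ∑ b, A.outputProb (F σ) (C b (σ b)) =
        ∑ x, A.resultProb (F σ) x * ∑ b, (if A.φ x ∈ C b (σ b) then 1 else 0) := by
      simp only [Algorithm.outputProb]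
      rw [Finset.sum_comm]
      simp only [Finset.mul_sum, mul_ite, mul_one, mul_zero]
    have e2 : ∑ x, A.resultProb (F σ) x *
        (3 / 4 * k * (1 - if A.φ x ∈ bad σ then 1 else 0)) ≤
        ∑ b, A.outputProb (F σ) (C b (σ b)) := by
      rw [e1]
      refine Finset.sum_le_sum fun x _ =>
        mul_le_mul_of_nonneg_left ?_ (A.resultProb_nonneg _ _)
      split_ifs with hx
      · simp only [sub_self, mul_zero]
        exact Finset.sum_nonneg fun b _ => by split_ifs <;> norm_num
      · have h3 := hgood σ _ hx
        have h4 : ∑ b, ∑ j, ((if j = σ b then 1 else 0 : ℝ) -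
            (if (A.φ x ∈ C b j ↔ j = σ b) then 0 else 1 : ℝ)) ≤
            ∑ b, (if A.φ x ∈ C b (σ b) then 1 else 0 : ℝ) := by
          refine Finset.sum_le_sum fun b _ => ?_
          have : (if A.φ x ∈ C b (σ b) then 1 else 0 : ℝ) =
            ∑ j, if j = σ b then (if A.φ x ∈ C b j then 1 else 0 : ℝ) else 0 := by simp
          rw [this]
          refine Finset.sum_le_sum fun j _ => ?_
          exact (hind _ _).2
        simp only [Finset.sum_sub_distrib, hone] at h4
        linarith
    have e3 : ∑ x, A.resultProb (F σ) x *
        (3 / 4 * k * (1 - if A.φ x ∈ bad σ then 1 else 0)) =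
        3 / 4 * k * (1 - A.outputProb (F σ) (bad σ)) := by
      have : ∀ x, A.resultProb (F σ) x * (3 / 4 * k * (1 - if A.φ x ∈ bad σ then 1 else 0)) =
          3 / 4 * k * A.resultProb (F σ) x -
            3 / 4 * k * (if A.φ x ∈ bad σ then A.resultProb (F σ) x else 0) := by
        intro x
        split_ifs <;> ring
      simp only [this, Finset.sum_sub_distrib, ← Finset.mul_sum, A.sum_resultProb,
        Algorithm.outputProb]
      ring
    have hk0 : (0 : ℝ) ≤ k := Nat.cast_nonneg k
    nlinarith [hbad σ]
  -- Outside `bad σ` at most `k + k/4` points are claimed to be marked; on `bad σ`, of probability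
  -- at most `1/4`, possibly all `k B`.
  have h2 : ∀ σ, ∑ b, ∑ j, A.outputProb (F σ) (C b j) ≤ 5 / 4 * k + k * B / 4 := by
    intro σ
    have e1 : ∑ b, ∑ j, A.outputProb (F σ) (C b j) =
        ∑ x, A.resultProb (F σ) x * ∑ b, ∑ j, (if A.φ x ∈ C b j then 1 else 0) := by
      simp only [Algorithm.outputProb, Finset.mul_sum, mul_ite, mul_one, mul_zero]
      rw [Finset.sum_comm' (t' := Finset.univ) (s' := fun _ => Finset.univ) (by simp)]
      conv_rhs => rw [Finset.sum_comm]
      rw [Finset.sum_comm]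
      refine Finset.sum_congr rfl fun b _ => ?_
      rw [Finset.sum_comm]
    have e2 : ∑ b, ∑ j, A.outputProb (F σ) (C b j) ≤ ∑ x, A.resultProb (F σ) x *
        (5 / 4 * k + k * B * if A.φ x ∈ bad σ then 1 else 0) := by
      rw [e1]
      refine Finset.sum_le_sum fun x _ =>
        mul_le_mul_of_nonneg_left ?_ (A.resultProb_nonneg _ _)
      split_ifs with hx
      · have : ∑ b : Fin k, ∑ j : Fin B, (if A.φ x ∈ C b j then 1 else 0 : ℝ) ≤
            ∑ b : Fin k, ∑ j : Fin B, 1 :=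
          Finset.sum_le_sum fun b _ => Finset.sum_le_sum fun j _ => by split_ifs <;> norm_num
        simp only [Finset.sum_const, Finset.card_univ, Fintype.card_fin, nsmul_eq_mul,
          mul_one] at this
        have hk0 : (0 : ℝ) ≤ k := Nat.cast_nonneg k
        simp only [mul_one]
        linarith
      · have h3 := hgood σ _ hx
        have h4 : ∑ b, ∑ j, (if A.φ x ∈ C b j then 1 else 0 : ℝ) ≤
            ∑ b, ∑ j, ((if j = σ b then 1 else 0 : ℝ) +
            (if (A.φ x ∈ C b j ↔ j = σ b) then 0 else 1 : ℝ)) := by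
          refine Finset.sum_le_sum fun b _ => Finset.sum_le_sum fun j _ => ?_
          exact (hind _ _).1
        simp only [Finset.sum_add_distrib, hone] at h4
        simp only [mul_zero, add_zero]
        linarith
    have e3 : ∑ x, A.resultProb (F σ) x *
        (5 / 4 * k + k * B * if A.φ x ∈ bad σ then 1 else 0) =
        5 / 4 * k + k * B * A.outputProb (F σ) (bad σ) := by
      simp only [mul_add, Finset.sum_add_distrib, ← Finset.sum_mul, A.sum_resultProb, one_mul,
        Algorithm.outputProb, Finset.mul_sum]
      congr 1
      refine Finset.sum_congr rfl fun x _ => ?_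
      split_ifs <;> ring
    have hk0 : (0 : ℝ) ≤ k * B := by positivity
    nlinarith [hbad σ]
  set R : (Fin k → Fin B) → (Fin k → Fin B) → ℝ := fun σ σ' =>
    1 - (∑ x, star (A.amp (F σ) x) * A.amp (F σ') x).re with hR
  have h3 : ∑ σ, ∑ b, ∑ i, (A.outputProb (F σ) (C b (σ b)) -
      A.outputProb (F (Function.update σ b i)) (C b (σ b))) ≤
      ∑ σ : Fin k → Fin B, ∑ b, ∑ i, (16 * R σ (Function.update σ b i) + 1 / 8) :=
    Finset.sum_le_sum fun σ _ => Finset.sum_le_sum fun b _ => Finset.sum_le_sum fun i _ =>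
      A.outputProb_sub_le _ _ _
  have h4 : ∑ σ : Fin k → Fin B, ∑ b, ∑ i, (16 * R σ (Function.update σ b i) + 1 / 8) ≤
      16 * (A.queries * (2 * √(B : ℝ)) * Fintype.card (Fin k → Fin B)) +
        Fintype.card (Fin k → Fin B) * (k * B * (1 / 8)) := by
    have := A.adversary_le (blockAdversary pos v₀ v₁ hB1)
    change ∑ σ, ∑ σ', blockWeight σ σ' * R σ σ' ≤ _ at this
    simp only [sum_blockWeight_mul] at this
    simp only [Finset.sum_add_distrib, ← Finset.mul_sum]
    refine add_le_add (mul_le_mul_of_nonneg_left this (by norm_num)) (le_of_eq ?_)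
    simp only [Finset.sum_const, Finset.card_univ, nsmul_eq_mul, Fintype.card_fin]
    ring
  -- After a reset the old mark is an arbitrary position of the block. By `sum_update`, the second
  -- terms therefore collect all claims, right or wrong.
  have h5 : ∑ σ, ∑ b, ∑ i, (A.outputProb (F σ) (C b (σ b)) -
      A.outputProb (F (Function.update σ b i)) (C b (σ b))) =
      ∑ σ, (B * ∑ b, A.outputProb (F σ) (C b (σ b)) -
        ∑ b, ∑ j, A.outputProb (F σ) (C b j)) := by
    simp only [Finset.sum_sub_distrib]
    congr 1
    · simp [Finset.mul_sum]
    · rw [Finset.sum_comm]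
      conv_rhs => rw [Finset.sum_comm]
      refine Finset.sum_congr rfl fun b _ => ?_
      exact sum_update b (fun σ j => A.outputProb (F σ) (C b j))
  -- `9/16 kB - 5/4 k - 1/4 kB` is at least `15/64 kB` because `B ≥ 16`. The loss `1/8 kB` from
  -- `outputProb_sub_le` leaves `7/64 kB ≤ 32 √B` times the number of queries, whence `7/2048`.
  have h6 : ∑ σ : Fin k → Fin B, (15 / 64 * (k * B) : ℝ) ≤
      ∑ σ, (B * ∑ b, A.outputProb (F σ) (C b (σ b)) -
        ∑ b, ∑ j, A.outputProb (F σ) (C b j)) := by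
    refine Finset.sum_le_sum fun σ _ => ?_
    have hB0 : (16 : ℝ) ≤ B := by exact_mod_cast hB
    have hk0 : (1 : ℝ) ≤ k := by exact_mod_cast hk
    nlinarith [h1 σ, h2 σ, mul_le_mul_of_nonneg_left (h1 σ) (by linarith : (0 : ℝ) ≤ B)]
  rw [Finset.sum_const, Finset.card_univ, nsmul_eq_mul] at h6
  rw [h5] at h3
  have hI : (0 : ℝ) < Fintype.card (Fin k → Fin B) := by
    exact_mod_cast Fintype.card_pos
  have h7 : (15 / 64 * (k * B) : ℝ) ≤
      16 * (A.queries * (2 * √(B : ℝ))) + k * B * (1 / 8) := by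
    have := h6.trans (h3.trans h4)
    refine le_of_mul_le_mul_left ?_ hI
    linarith
  have hs : 0 < √(B : ℝ) := Real.sqrt_pos.2 (by exact_mod_cast hB1)
  have hs2 : √(B : ℝ) * √(B : ℝ) = B := Real.mul_self_sqrt (Nat.cast_nonneg B)
  refine le_of_mul_le_mul_right ?_ hs
  have : (7 / 2048 * (k * √(B : ℝ))) * √(B : ℝ) = 7 / 2048 * (k * B) := by
    rw [mul_assoc, mul_assoc, hs2]
  rw [this]
  linarith

end Blocks

/-! ### Norms of functions on `{0, …, N-1}` -/

namespace LpN

variable {p q : ℝ≥0∞} {N : ℕ}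

theorem norm_of_top (f : Fin N → ℝ) : ‖of ∞ N f‖ = ⨆ i, |f i| := by
  rw [norm_def, if_pos rfl]; rfl

theorem norm_of_ne_top (hp : p ≠ ∞) (f : Fin N → ℝ) :
    ‖of p N f‖ = ((1 / N : ℝ) * ∑ i, |f i| ^ p.toReal) ^ (1 / p.toReal) := by
  rw [norm_def, if_neg hp]; rfl

theorem toReal_pos_of_one_le (hp1 : 1 ≤ p) (hp : p ≠ ∞) : 0 < p.toReal :=
  ENNReal.toReal_pos (zero_lt_one.trans_le hp1).ne' hp

theorem one_le_toReal (hp1 : 1 ≤ p) (hp : p ≠ ∞) : 1 ≤ p.toReal := by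
  simpa using ENNReal.toReal_mono hp hp1

theorem abs_le_norm_top (f : Fin N → ℝ) (i : Fin N) : |f i| ≤ ‖of ∞ N f‖ := by
  rw [norm_of_top]
  exact le_ciSup (Set.finite_range fun i => |f i|).bddAbove i

/-- A function that is large on a set has a large norm. -/
theorem le_norm_of_card (hq1 : 1 ≤ q) (d : Fin N → ℝ) (s : Finset (Fin N)) (hs : s.Nonempty)
    {η : ℝ} (hη : 0 ≤ η) (h : ∀ i ∈ s, η ≤ |d i|) :
    ((s.card : ℝ) / N) ^ (1 / q.toReal) * η ≤ ‖of q N d‖ := by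
  by_cases hq : q = ∞
  · subst hq
    obtain ⟨i, hi⟩ := hs
    simpa using (h i hi).trans (abs_le_norm_top d i)
  · have h0 := toReal_pos_of_one_le hq1 hq
    rw [norm_of_ne_top hq]
    have h1 : η = (η ^ q.toReal) ^ (1 / q.toReal) := by
      rw [← Real.rpow_mul hη, mul_one_div_cancel h0.ne', Real.rpow_one]
    rw [h1]
    clear h1
    rw [← Real.mul_rpow (by positivity) (by positivity)]
    refine Real.rpow_le_rpow (by positivity) ?_ (by positivity)
    rw [div_mul_eq_mul_div, div_eq_mul_one_div, mul_comm]
    refine mul_le_mul_of_nonneg_left ?_ (by positivity)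
    calc (s.card : ℝ) * η ^ q.toReal = ∑ i ∈ s, η ^ q.toReal := by simp
      _ ≤ ∑ i ∈ s, |d i| ^ q.toReal :=
        Finset.sum_le_sum fun i hi => Real.rpow_le_rpow hη (h i hi) h0.le
      _ ≤ ∑ i, |d i| ^ q.toReal :=
        Finset.sum_le_sum_of_subset_of_nonneg (Finset.subset_univ s) fun i _ _ => by positivity

/-- A bounded function with small support has a small norm. -/
theorem norm_le_of_card (hp1 : 1 ≤ p) (d : Fin N → ℝ) (s : Finset (Fin N))
    {η : ℝ} (hη : 0 ≤ η) (h : ∀ i, |d i| ≤ η) (h0 : ∀ i ∉ s, d i = 0) :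
    ‖of p N d‖ ≤ ((s.card : ℝ) / N) ^ (1 / p.toReal) * η := by
  by_cases hp : p = ∞
  · subst hp
    rw [norm_of_top]
    simpa using Real.iSup_le h hη
  · have hp0 := toReal_pos_of_one_le hp1 hp
    rw [norm_of_ne_top hp]
    have h1 : η = (η ^ p.toReal) ^ (1 / p.toReal) := by
      rw [← Real.rpow_mul hη, mul_one_div_cancel hp0.ne', Real.rpow_one]
    rw [h1]
    clear h1
    rw [← Real.mul_rpow (by positivity) (by positivity)]
    refine Real.rpow_le_rpow (by positivity) ?_ (by positivity)
    rw [div_mul_eq_mul_div, div_mul_eq_mul_div, one_mul]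
    refine div_le_div_of_nonneg_right ?_ (Nat.cast_nonneg N)
    calc ∑ i, |d i| ^ p.toReal = ∑ i ∈ s, |d i| ^ p.toReal := by
          refine (Finset.sum_subset (Finset.subset_univ s) fun i _ hi => ?_).symm
          rw [h0 i hi, abs_zero, Real.zero_rpow hp0.ne']
      _ ≤ ∑ i ∈ s, η ^ p.toReal :=
        Finset.sum_le_sum fun i _ => Real.rpow_le_rpow (abs_nonneg _) (h i) hp0.le
      _ = (s.card : ℝ) * η ^ p.toReal := by simp

theorem sum_le_of_norm_le_one (hp1 : 1 ≤ p) (hp : p ≠ ∞) (hN : 1 ≤ N) {f : Fin N → ℝ}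
    (hf : ‖of p N f‖ ≤ 1) : ∑ i, |f i| ^ p.toReal ≤ N := by
  have hp0 := toReal_pos_of_one_le hp1 hp
  rw [norm_of_ne_top hp] at hf
  have hN0 : (0 : ℝ) < N := by exact_mod_cast hN
  have h1 : (1 / N : ℝ) * ∑ i, |f i| ^ p.toReal ≤ 1 := by
    by_contra! h
    exact absurd hf (not_le.2 (Real.one_lt_rpow h (by positivity)))
  rw [one_div, inv_mul_le_iff₀ hN0] at h1
  simpa using h1

/-- Interpolation: a function that is bounded by `t` and by a function in the unit ball of
`L_p^N` is small in `L_q^N`. -/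
theorem norm_le_rpow (hp1 : 1 ≤ p) (hpq : p < q) (hN : 1 ≤ N) {f d : Fin N → ℝ} {t : ℝ}
    (ht : 0 < t) (hf : ‖of p N f‖ ≤ 1) (h1 : ∀ i, |d i| ≤ t) (h2 : ∀ i, |d i| ≤ |f i|) :
    ‖of q N d‖ ≤ t ^ (1 - p.toReal / q.toReal) := by
  have hp : p ≠ ∞ := hpq.ne_top
  have hp0 := toReal_pos_of_one_le hp1 hp
  have hN0 : (0 : ℝ) < N := by exact_mod_cast hN
  by_cases hq : q = ∞
  · subst hq
    rw [norm_of_top]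
    simpa using Real.iSup_le h1 ht.le
  · have hq0 := toReal_pos_of_one_le (hp1.trans hpq.le) hq
    have hpq' : p.toReal < q.toReal := (ENNReal.toReal_lt_toReal hp hq).2 hpq
    rw [norm_of_ne_top hq]
    have h3 : t ^ (1 - p.toReal / q.toReal) = (t ^ (q.toReal - p.toReal)) ^ (1 / q.toReal) := by
      rw [← Real.rpow_mul ht.le]
      congr 1
      field_simp
    rw [h3]
    refine Real.rpow_le_rpow (by positivity) ?_ (by positivity)
    rw [one_div, inv_mul_le_iff₀ hN0, mul_comm]
    have h4 : ∀ i, |d i| ^ q.toReal ≤ t ^ (q.toReal - p.toReal) * |f i| ^ p.toReal := by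
      intro i
      have : q.toReal = (q.toReal - p.toReal) + p.toReal := by ring
      nth_rw 1 [this]
      rw [Real.rpow_add' (abs_nonneg _) (by linarith)]
      exact mul_le_mul (Real.rpow_le_rpow (abs_nonneg _) (h1 i) (by linarith))
        (Real.rpow_le_rpow (abs_nonneg _) (h2 i) hp0.le) (by positivity) (by positivity)
    calc ∑ i, |d i| ^ q.toReal ≤ ∑ i, t ^ (q.toReal - p.toReal) * |f i| ^ p.toReal :=
          Finset.sum_le_sum fun i _ => h4 i
      _ = t ^ (q.toReal - p.toReal) * ∑ i, |f i| ^ p.toReal := by rw [Finset.mul_sum]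
      _ ≤ t ^ (q.toReal - p.toReal) * N :=
        mul_le_mul_of_nonneg_left (sum_le_of_norm_le_one hp1 hp hN hf) (by positivity)

theorem abs_le_of_norm_le_one (hp1 : 1 ≤ p) (hp : p ≠ ∞) (hN : 1 ≤ N) {f : Fin N → ℝ}
    (hf : ‖of p N f‖ ≤ 1) (i : Fin N) : |f i| ≤ (N : ℝ) ^ (1 / p.toReal) := by
  have hp0 := toReal_pos_of_one_le hp1 hp
  have h1 : |f i| ^ p.toReal ≤ N :=
    (Finset.single_le_sum (f := fun i => |f i| ^ p.toReal) (fun i _ => by positivity)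
      (Finset.mem_univ i)).trans (sum_le_of_norm_le_one hp1 hp hN hf)
  calc |f i| = (|f i| ^ p.toReal) ^ (1 / p.toReal) := by
        rw [← Real.rpow_mul (abs_nonneg _), mul_one_div_cancel hp0.ne', Real.rpow_one]
    _ ≤ _ := Real.rpow_le_rpow (by positivity) h1 (by positivity)

/-- Only few values of a function in the unit ball are large. -/
theorem card_mul_le (hp1 : 1 ≤ p) (hp : p ≠ ∞) (hN : 1 ≤ N) {f : Fin N → ℝ}
    (hf : ‖of p N f‖ ≤ 1) {t : ℝ} (ht : 0 ≤ t) :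
    ((Finset.univ.filter fun i => t ≤ |f i|).card : ℝ) * t ^ p.toReal ≤ N := by
  have hp0 := toReal_pos_of_one_le hp1 hp
  refine le_trans ?_ (sum_le_of_norm_le_one hp1 hp hN hf)
  calc _ = ∑ i ∈ Finset.univ.filter (fun i => t ≤ |f i|), t ^ p.toReal := by simp
    _ ≤ ∑ i ∈ Finset.univ.filter (fun i => t ≤ |f i|), |f i| ^ p.toReal :=
      Finset.sum_le_sum fun i hi => Real.rpow_le_rpow ht (Finset.mem_filter.1 hi).2 hp0.le
    _ ≤ _ := Finset.sum_le_sum_of_subset_of_nonneg (Finset.subset_univ _)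
      fun i _ _ => by positivity

/-- The norms are means over a probability measure, hence monotone in the exponent; for finite
exponents this is Jensen's inequality with power `p/q`. -/
theorem norm_le_one_of_le (hq1 : 1 ≤ q) (hqp : q ≤ p) (hN : 1 ≤ N) {f : Fin N → ℝ}
    (hf : ‖of p N f‖ ≤ 1) : ‖of q N f‖ ≤ 1 := by
  have hN0 : (0 : ℝ) < N := by exact_mod_cast hN
  by_cases hq : q = ∞
  · subst hq
    obtain rfl := top_le_iff.1 hqp
    exact hf
  have hq0 := toReal_pos_of_one_le hq1 hq
  by_cases hp : p = ∞
  · subst hp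
    refine (norm_le_of_card hq1 f Finset.univ zero_le_one
      (fun i => (abs_le_norm_top f i).trans hf) (by simp)).trans ?_
    simp [hN0.ne']
  · have h1 := sum_le_of_norm_le_one (hq1.trans hqp) hp hN hf
    rw [norm_of_ne_top hq]
    refine Real.rpow_le_one (by positivity) ?_ (by positivity)
    have hr : 1 ≤ p.toReal / q.toReal := by
      rw [one_le_div hq0]
      exact (ENNReal.toReal_le_toReal hq hp).2 hqp
    have h2 := Real.rpow_arith_mean_le_arith_mean_rpow Finset.univ (fun _ : Fin N => (1 / N : ℝ))
      (fun i => |f i| ^ q.toReal) (fun i _ => by positivity) (by simp [hN0.ne'])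
      (fun i _ => by positivity) hr
    have h3 : ∀ i, (|f i| ^ q.toReal) ^ (p.toReal / q.toReal) = |f i| ^ p.toReal := by
      intro i
      rw [← Real.rpow_mul (abs_nonneg _), mul_div_cancel₀ _ hq0.ne']
    simp only [h3, ← Finset.mul_sum] at h2
    by_contra! h
    have h4 := Real.one_lt_rpow h (lt_of_lt_of_le zero_lt_one hr)
    have h5 : (1 / N : ℝ) * ∑ i, |f i| ^ p.toReal ≤ 1 := by
      rw [one_div, inv_mul_le_iff₀ hN0]
      simpa using h1
    linarith

end LpN

/-! ### The lower bound -/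

/-- If `n` is small compared to `k √B`, then `n` queries do not suffice to find most of the marked
points in `k` blocks of length `B`. -/
theorem le_embedError (p q : ℝ≥0∞) [hp : Fact (1 ≤ p)] [hq : Fact (1 ≤ q)] {n N k B : ℕ}
    (hB : 16 ≤ B) (hk : 1 ≤ k) (hkB : k * B ≤ N) (hn : (n : ℝ) < 7 / 2048 * (k * √(B : ℝ))) :
    ENNReal.ofReal (1 / 8 * ((N : ℝ) / k) ^ (1 / p.toReal - 1 / q.toReal)) ≤
      embedError p q n N := by
  classical
  have hN : 1 ≤ N := by nlinarith
  have hN0 : (0 : ℝ) < N := by exact_mod_cast hN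
  have hk0 : (0 : ℝ) < k := by exact_mod_cast hk
  obtain ⟨emb⟩ : Nonempty (Fin k × Fin B ↪ Fin N) :=
    Function.Embedding.nonempty_of_card_le (by simpa using hkB)
  set pos : Fin N → Option (Fin k × Fin B) := Function.partialInv emb with hpos
  have hpos' : ∀ d x, pos d = some x ↔ emb x = d := fun d x =>
    emb.injective.isPartialInv x d
  -- The height at which `k` spikes have norm one. As `∞.toReal = 0` and `1 / 0 = 0`, this is also
  -- right for `p = ∞`.
  set h : ℝ := ((N : ℝ) / k) ^ (1 / p.toReal) with hh
  have hh0 : 0 < h := by positivity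
  set F := blockInput pos (0 : ℝ) h with hF
  have hFe : ∀ σ b j, F σ (emb (b, j)) = if j = σ b then h else 0 := by
    intro σ b j
    simp only [hF, blockInput, Marked, hpos']
    refine if_congr ⟨?_, ?_⟩ rfl rfl
    · rintro ⟨b', hb⟩
      have := emb.injective hb
      simp only [Prod.mk.injEq] at this
      obtain ⟨rfl, rfl⟩ := this
      rfl
    · rintro rfl
      exact ⟨b, rfl⟩
  have hball : ∀ σ, F σ ∈ LpN.unitBall p N := by
    intro σ
    set s : Finset (Fin N) := Finset.univ.image fun b => emb (b, σ b) with hs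
    have hc : s.card = k := by
      rw [hs, Finset.card_image_of_injective, Finset.card_univ, Fintype.card_fin]
      intro b b' hb
      exact (Prod.mk.inj (emb.injective hb)).1
    refine (LpN.norm_le_of_card hp.out (F σ) s hh0.le ?_ ?_).trans (le_of_eq ?_)
    · intro i
      simp only [hF, blockInput]
      split_ifs
      · rw [abs_of_pos hh0]
      · simpa using hh0.le
    · intro i hi
      simp only [hF, blockInput]
      rw [if_neg]
      rintro ⟨b, hb⟩
      exact hi (Finset.mem_image.2 ⟨b, Finset.mem_univ b, (hpos' _ _).1 hb⟩)
    · rw [hc, hh, ← Real.mul_rpow (by positivity) (by positivity)]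
      rw [div_mul_div_cancel₀ hN0.ne', div_self hk0.ne', Real.one_rpow]
  set E : ℝ := 1 / 8 * ((N : ℝ) / k) ^ (1 / p.toReal - 1 / q.toReal) with hE
  -- The factor `1/8` is `1/2` from `h / 2` times `1/4 ≤ (1/4)^(1/q)`.
  have hEle : E ≤ ((k : ℝ) / 4 / N) ^ (1 / q.toReal) * (h / 2) := by
    have h1 : (k : ℝ) / 4 / N = (1 / 4) * (k / N) := by ring
    have h2 : (1 / 4 : ℝ) ≤ (1 / 4) ^ (1 / q.toReal) := by
      have : (1 / 4 : ℝ) ^ (1 : ℝ) ≤ (1 / 4) ^ (1 / q.toReal) := by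
        refine Real.rpow_le_rpow_of_exponent_ge (by norm_num) (by norm_num) ?_
        by_cases hq' : q = ∞
        · simp [hq']
        · rw [div_le_one (LpN.toReal_pos_of_one_le hq.out hq')]
          exact LpN.one_le_toReal hq.out hq'
      simpa using this
    have h3 : ((k : ℝ) / N) ^ (1 / q.toReal) = ((N : ℝ) / k) ^ (-(1 / q.toReal)) := by
      rw [Real.rpow_neg (by positivity), ← Real.inv_rpow (by positivity), inv_div]
    rw [h1, Real.mul_rpow (by positivity) (by positivity), h3, hE, sub_eq_add_neg,
      Real.rpow_add (by positivity), ← hh]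
    have h4 : 0 < ((N : ℝ) / k) ^ (-(1 / q.toReal)) * h := by positivity
    nlinarith
  by_contra! hlt
  unfold embedError minError minErrorWith at hlt
  obtain ⟨A, hA⟩ := iInf_lt_iff.1 hlt
  obtain ⟨hAn, hA⟩ := iInf_lt_iff.1 hA
  set S : LpN.unitBall p N → LpN q N := fun f => LpN.embed p q N (LpN.of p N f) with hS
  -- The output claims a mark where it exceeds `h / 2`, so each wrong claim costs at least `h / 2`.
  -- The bad event has the non-strict `E ≤`: some admissible `ε` is strictly below `E`, and its
  -- event `ε < ‖·‖` contains this one.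
  have key := le_queries_of_blocks pos (0 : ℝ) h A hB hk
    (fun b j => {g | h / 2 < (LpN.of q N).symm g (emb (b, j))})
    (fun σ => {g | E ≤ ‖S ⟨F σ, hball σ⟩ - g‖}) ?_ ?_
  · have : (A.queries : ℝ) ≤ n := by exact_mod_cast hAn
    linarith
  · intro σ
    have h1 : errorAt S A ⟨F σ, hball σ⟩ (1 / 4) < ENNReal.ofReal E :=
      (le_iSup (fun f => errorAt S A f (1 / 4)) ⟨F σ, hball σ⟩).trans_lt hA
    obtain ⟨ε, hε⟩ := iInf_lt_iff.1 h1
    obtain ⟨hε, hεE⟩ := iInf_lt_iff.1 hε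
    refine le_trans (A.outputProb_mono _ ?_) hε
    intro g hg
    have : (ε : ℝ) < E := by
      rw [ENNReal.lt_ofReal_iff_toReal_lt ENNReal.coe_ne_top] at hεE
      simpa using hεE
    exact this.trans_le hg
  · intro σ g hg
    simp only [Set.mem_ofPred_eq, not_le] at hg
    set g' : Fin N → ℝ := (LpN.of q N).symm g with hg'
    have hnorm : ‖S ⟨F σ, hball σ⟩ - g‖ = ‖LpN.of q N (fun i => F σ i - g' i)‖ := rfl
    rw [hnorm] at hg
    by_contra! hw
    simp only [Set.mem_ofPred_eq] at hw
    set w : Finset (Fin k × Fin B) :=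
      Finset.univ.filter fun x => ¬ (h / 2 < g' (emb x) ↔ x.2 = σ x.1) with hwdef
    have hwc : ∑ b, ∑ j, (if (h / 2 < g' (emb (b, j)) ↔ j = σ b) then 0 else 1 : ℝ) =
        w.card := by
      rw [← Fintype.sum_prod_type' (f := fun b j =>
        (if (h / 2 < g' (emb (b, j)) ↔ j = σ b) then 0 else 1 : ℝ)), hwdef,
        Finset.card_filter]
      push_cast
      refine Finset.sum_congr rfl fun x _ => ?_
      split_ifs <;> tauto
    have hw' : (k : ℝ) / 4 < w.card := by
      rw [← hwc]
      convert hw using 4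
    have hne : w.Nonempty := by
      rw [← Finset.card_pos]
      have : (0 : ℝ) < w.card := lt_trans (by positivity) hw'
      exact_mod_cast this
    have h1 := LpN.le_norm_of_card hq.out (fun i => F σ i - g' i) (w.map emb) (hne.map)
      (η := h / 2) (by positivity) (by
        intro i hi
        obtain ⟨⟨b, j⟩, hx, rfl⟩ := Finset.mem_map.1 hi
        have hx2 := (Finset.mem_filter.1 hx).2
        simp only at hx2
        rw [hFe]
        by_cases hj : j = σ b
        · simp only [hj, if_true]
          simp only [hj, iff_true, not_lt] at hx2
          exact le_trans (by linarith) (le_abs_self _)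
        · simp only [hj, if_false]
          simp only [hj, iff_false, not_not] at hx2
          rw [zero_sub, abs_neg]
          exact hx2.le.trans (le_abs_self _))
    rw [Finset.card_map] at h1
    have h2 : ((k : ℝ) / 4 / N) ^ (1 / q.toReal) * (h / 2) ≤
        ((w.card : ℝ) / N) ^ (1 / q.toReal) * (h / 2) := by
      gcongr
    linarith

/-! ### Unitary matrices -/

/-- A unit vector extends to an orthonormal basis, whose coordinates are the columns of a unitary
matrix. -/
theorem exists_unitary_col {ι : Type*} [Fintype ι] [DecidableEq ι] (i₀ : ι) (v : ι → ℂ)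
    (hv : ∑ i, ‖v i‖ ^ 2 = 1) :
    ∃ U : Matrix.unitaryGroup ι ℂ, (U : Matrix ι ι ℂ).mulVec (Pi.single i₀ 1) = v := by
  set w : EuclideanSpace ℂ ι := WithLp.toLp 2 v with hw
  have hw1 : ‖w‖ = 1 := by
    rw [EuclideanSpace.norm_eq]
    simp [hw, hv]
  have ho : Orthonormal ℂ (({i₀} : Set ι).domRestrict fun _ => w) := by
    constructor
    · intro i; exact hw1
    · intro i j hij
      exact absurd (Subsingleton.elim i j) hij
  obtain ⟨b, hb⟩ := ho.exists_orthonormalBasis_extension_of_card_eq (by simp)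
  refine ⟨⟨(EuclideanSpace.basisFun ι ℂ).toBasis.toMatrix b,
    OrthonormalBasis.toMatrix_orthonormalBasis_mem_unitary _ _⟩, ?_⟩
  ext i
  rw [Matrix.mulVec_single]
  simp [Module.Basis.toMatrix_apply, hb i₀ rfl, hw]

theorem exists_unitary_to_single {ι : Type*} [Fintype ι] [DecidableEq ι] (i₀ : ι) (v : ι → ℂ)
    (hv : ∑ i, ‖v i‖ ^ 2 = 1) :
    ∃ U : Matrix.unitaryGroup ι ℂ, (U : Matrix ι ι ℂ).mulVec v = Pi.single i₀ 1 := by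
  obtain ⟨U, hU⟩ := exists_unitary_col i₀ v hv
  refine ⟨star U, ?_⟩
  rw [← hU, Matrix.mulVec_mulVec]
  change (star (U : Matrix ι ι ℂ) * (U : Matrix ι ι ℂ)).mulVec _ = _
  rw [Matrix.mem_unitaryGroup_iff'.1 U.2, Matrix.one_mulVec]

/-- The reflection `2 v v* - 1` in a unit vector. -/
theorem reflection_mem_unitary {ι : Type*} [Fintype ι] [DecidableEq ι] (v : ι → ℂ)
    (hv : ∑ i, ‖v i‖ ^ 2 = 1) :
    (2 : ℂ) • Matrix.vecMulVec v (star v) - 1 ∈ Matrix.unitaryGroup ι ℂ := by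
  rw [Matrix.mem_unitaryGroup_iff]
  have h1 : star ((2 : ℂ) • Matrix.vecMulVec v (star v) - 1) =
      (2 : ℂ) • Matrix.vecMulVec v (star v) - 1 := by
    simp [Matrix.star_eq_conjTranspose, Matrix.conjTranspose_vecMulVec]
  have h2 : Matrix.vecMulVec v (star v) * Matrix.vecMulVec v (star v) =
      Matrix.vecMulVec v (star v) := by
    rw [Matrix.vecMulVec_mul_vecMulVec, star_dotProduct_self_eq, hv]
    simp
  rw [h1, sub_mul, mul_sub, mul_sub, smul_mul_smul_comm, h2]
  simp only [mul_one, one_mul]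
  module

theorem diagonal_sign_mem_unitary {ι : Type*} [Fintype ι] [DecidableEq ι] (s : ι → Prop)
    [DecidablePred s] :
    Matrix.diagonal (fun i => if s i then (-1 : ℂ) else 1) ∈ Matrix.unitaryGroup ι ℂ := by
  rw [Matrix.mem_unitaryGroup_iff, Matrix.star_eq_conjTranspose, Matrix.diagonal_conjTranspose,
    Matrix.diagonal_mul_diagonal, ← Matrix.diagonal_one]
  congr 1
  funext i
  simp only [Pi.star_apply]
  split_ifs <;> simp

namespace Query

variable {D K : Type*} (Q : Query D K)

/-! ### States reachable with a given number of queries -/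

/-- The states `v f` that an algorithm with no measurement reaches with `n` queries. -/
def Reach (z₀ : Fin (2 ^ Q.m)) (n : ℕ) (v : (D → K) → Fin (2 ^ Q.m) → ℂ) : Prop :=
  ∃ U : Fin (n + 1) → Matrix.unitaryGroup (Fin (2 ^ Q.m)) ℂ, ∀ f,
    (alternate (Q.mat f) n (fun j => (U j : Matrix _ _ ℂ))).mulVec (Pi.single z₀ 1) = v f

variable {Q} {z₀ : Fin (2 ^ Q.m)} {n : ℕ} {v : (D → K) → Fin (2 ^ Q.m) → ℂ}

theorem reach_zero (w : Fin (2 ^ Q.m) → ℂ) (hw : ∑ z, ‖w z‖ ^ 2 = 1) :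
    Q.Reach z₀ 0 fun _ => w := by
  obtain ⟨U, hU⟩ := exists_unitary_col z₀ w hw
  exact ⟨fun _ => U, fun f => hU⟩

/-- In `Reach` the unitaries are chosen before `f`; since `W` does not depend on `f`, it merges into
the last one at no query cost. -/
theorem Reach.mul (h : Q.Reach z₀ n v) {W : Matrix (Fin (2 ^ Q.m)) (Fin (2 ^ Q.m)) ℂ}
    (hW : W ∈ Matrix.unitaryGroup (Fin (2 ^ Q.m)) ℂ) :
    Q.Reach z₀ n fun f => W.mulVec (v f) := by
  obtain ⟨U, hU⟩ := h
  cases n with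
  | zero =>
    refine ⟨fun _ => ⟨W, hW⟩ * U 0, fun f => ?_⟩
    beta_reduce
    rw [← hU f, Matrix.mulVec_mulVec]
    rfl
  | succ n =>
    refine ⟨Function.update U (Fin.last _) (⟨W, hW⟩ * U (Fin.last _)), fun f => ?_⟩
    beta_reduce
    rw [← hU f, Matrix.mulVec_mulVec]
    congr 1
    simp [alternate, Matrix.mul_assoc]

theorem Reach.query (h : Q.Reach z₀ n v) :
    Q.Reach z₀ (n + 1) fun f => (Q.mat f).mulVec (v f) := by
  obtain ⟨U, hU⟩ := h
  refine ⟨Fin.snoc U 1, fun f => ?_⟩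
  beta_reduce
  rw [← hU f, Matrix.mulVec_mulVec]
  congr 1
  simp [alternate]

/-! ### Product states -/

variable (Q)

/-- The product vector `c ⊗ χ ⊗ e_0`. -/
def tens (c : Fin (2 ^ Q.mi) → ℂ) (χ : Fin (2 ^ Q.mv) → ℂ) (z : Fin (2 ^ Q.m)) : ℂ :=
  c (Q.split z).1 * χ (Q.split z).2.1 * if (Q.split z).2.2 = 0 then 1 else 0

theorem sum_split {R : Type*} [AddCommMonoid R] (g : Fin (2 ^ Q.mi) → Fin (2 ^ Q.mv) →
    Fin (2 ^ (Q.m - Q.mi - Q.mv)) → R) :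
    ∑ z, g (Q.split z).1 (Q.split z).2.1 (Q.split z).2.2 = ∑ i, ∑ x, ∑ y, g i x y := by
  rw [Equiv.sum_comp Q.split (fun s => g s.1 s.2.1 s.2.2), Fintype.sum_prod_type]
  simp only [Fintype.sum_prod_type]

theorem star_tens_dotProduct (c c' : Fin (2 ^ Q.mi) → ℂ) (χ χ' : Fin (2 ^ Q.mv) → ℂ) :
    star (Q.tens c χ) ⬝ᵥ Q.tens c' χ' = (star c ⬝ᵥ c') * (star χ ⬝ᵥ χ') := by
  simp only [dotProduct, Pi.star_apply, tens]
  rw [Q.sum_split (fun i x y => star (c i * χ x * if y = 0 then 1 else 0) *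
    (c' i * χ' x * if y = 0 then 1 else 0))]
  simp only [mul_ite, mul_one, mul_zero, Finset.sum_ite_eq', Finset.mem_univ, if_true]
  rw [Finset.sum_mul_sum]
  refine Finset.sum_congr rfl fun i _ => Finset.sum_congr rfl fun x _ => ?_
  simp only [star_mul']
  ring

theorem sum_norm_sq_tens (c : Fin (2 ^ Q.mi) → ℂ) (χ : Fin (2 ^ Q.mv) → ℂ) :
    ∑ z, ‖Q.tens c χ z‖ ^ 2 = (∑ i, ‖c i‖ ^ 2) * ∑ x, ‖χ x‖ ^ 2 := by
  have h := Q.star_tens_dotProduct c c χ χ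
  simp only [star_dotProduct_self_eq] at h
  exact_mod_cast h

/-- The operator that applies `H` to the value register. -/
theorem exists_unitary_value (H : Matrix.unitaryGroup (Fin (2 ^ Q.mv)) ℂ) :
    ∃ W ∈ Matrix.unitaryGroup (Fin (2 ^ Q.m)) ℂ, ∀ c χ,
      W.mulVec (Q.tens c χ) = Q.tens c ((H : Matrix _ _ ℂ).mulVec χ) := by
  set M := Matrix.kronecker (1 : Matrix (Fin (2 ^ Q.mi)) (Fin (2 ^ Q.mi)) ℂ)
    (Matrix.kronecker (H : Matrix (Fin (2 ^ Q.mv)) (Fin (2 ^ Q.mv)) ℂ)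
      (1 : Matrix (Fin (2 ^ (Q.m - Q.mi - Q.mv))) (Fin (2 ^ (Q.m - Q.mi - Q.mv))) ℂ)) with hM
  have hMu : M ∈ Matrix.unitaryGroup _ ℂ :=
    Matrix.kronecker_mem_unitary (one_mem _) (Matrix.kronecker_mem_unitary H.2 (one_mem _))
  refine ⟨M.submatrix Q.split Q.split, ?_, ?_⟩
  · rw [Matrix.mem_unitaryGroup_iff, Matrix.star_eq_conjTranspose,
      Matrix.conjTranspose_submatrix, Matrix.submatrix_mul_equiv,
      ← Matrix.star_eq_conjTranspose, Matrix.mem_unitaryGroup_iff.1 hMu,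
      Matrix.submatrix_one_equiv]
  · intro c χ
    ext z
    simp only [Matrix.mulVec, dotProduct, tens, Matrix.submatrix_apply]
    rw [Q.sum_split (fun i x y => M (Q.split z) (i, x, y) *
      (c i * χ x * if y = 0 then 1 else 0))]
    simp only [hM, Matrix.kronecker, Matrix.kroneckerMap_apply, Matrix.one_apply]
    simp only [mul_ite, mul_one, mul_zero, ite_mul, one_mul, zero_mul, Finset.sum_ite_eq',
      Finset.mem_univ, if_true]
    rw [Finset.sum_eq_single (Q.split z).1]
    · simp only [if_true]
      split_ifs with h
      · simp only [Finset.mul_sum]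
        refine Finset.sum_congr rfl fun x _ => ?_
        ring
      · simp
    · intro i _ hi
      simp [hi.symm]
    · simp

end Query

namespace Query

variable {D K : Type*} (Q : Query D K)

/-! ### Grover iterations -/

/-- The state of the value register for which a query acts as a change of sign. -/
def signState (x : Fin (2 ^ Q.mv)) : ℂ := (-1) ^ x.val * ((√(2 ^ Q.mv : ℝ))⁻¹ : ℝ)

theorem sum_norm_sq_signState : ∑ x, ‖Q.signState x‖ ^ 2 = 1 := by
  have h : ∀ x, ‖Q.signState x‖ ^ 2 = ((2 : ℝ) ^ Q.mv)⁻¹ := by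
    intro x
    rw [signState, norm_mul, norm_pow, norm_neg, norm_one, one_pow, one_mul, Complex.norm_real,
      Real.norm_of_nonneg (by positivity), inv_pow, Real.sq_sqrt (by positivity)]
  simp [h]

/-- Phase kickback. As `mv ≥ 1`, the modulus `2 ^ mv` is even and reduction keeps the parity, so a
query turns an odd value into a sign and nothing has to be uncomputed. -/
theorem signState_add (x b : Fin (2 ^ Q.mv)) :
    Q.signState (x + b) = (-1) ^ b.val * Q.signState x := by
  have h : (-1 : ℂ) ^ (x + b).val = (-1) ^ b.val * (-1) ^ x.val := by
    rw [Fin.val_add, neg_one_pow_eq_pow_mod_two, Nat.mod_mod_of_dvd _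
      (dvd_pow_self 2 (Nat.one_le_iff_ne_zero.1 Q.mv_pos)), ← neg_one_pow_eq_pow_mod_two, pow_add,
      mul_comm]
  rw [signState, h, signState, mul_assoc]

theorem act_surjective (f : D → K) : Function.Surjective (Q.act f) := (Q.perm f).surjective

theorem split_act_of_mem (f : D → K) {z : Fin (2 ^ Q.m)} (h : (Q.split z).1 ∈ Q.Z) :
    Q.split (Q.act f z) = ((Q.split z).1,
      (Q.split z).2.1 + Q.β (f (Q.τ ⟨(Q.split z).1, h⟩)), (Q.split z).2.2) := by
  rw [act, dif_pos h, Equiv.apply_symm_apply]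

open Classical in
/-- The marked indices: those at which the query reads an odd value, and those in `T` at which it
reads nothing. -/
def MarkedIdx (T : Set (Fin (2 ^ Q.mi))) (f : D → K) (i : Fin (2 ^ Q.mi)) : Prop :=
  if h : i ∈ Q.Z then Odd (Q.β (f (Q.τ ⟨i, h⟩))).val else i ∈ T

open Classical in
/-- The number of marked indices. -/
def numMarked (T : Set (Fin (2 ^ Q.mi))) (f : D → K) : ℕ :=
  (Finset.univ.filter fun i => Q.MarkedIdx T f i).card

open Classical in
/-- The change of sign at the marked indices, by one query and a diagonal operator. -/
theorem exists_unitary_flip (T : Set (Fin (2 ^ Q.mi))) :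
    ∃ W ∈ Matrix.unitaryGroup (Fin (2 ^ Q.m)) ℂ, ∀ f c,
      W.mulVec ((Q.mat f).mulVec (Q.tens c Q.signState)) =
        Q.tens (fun i => (if Q.MarkedIdx T f i then -1 else 1) * c i) Q.signState := by
  refine ⟨_, diagonal_sign_mem_unitary fun z => (Q.split z).1 ∉ Q.Z ∧ (Q.split z).1 ∈ T, ?_⟩
  intro f c
  ext z'
  obtain ⟨z, rfl⟩ := Q.act_surjective f z'
  rw [Matrix.mulVec_diagonal, mat_mulVec_act]
  simp only [tens, split_act_fst]
  by_cases h : (Q.split z).1 ∈ Q.Z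
  · rw [Q.split_act_of_mem f h]
    simp only [MarkedIdx, h, not_true_eq_false, false_and, if_false, one_mul, dif_pos,
      signState_add]
    by_cases h1 : Odd (Q.β (f (Q.τ ⟨(Q.split z).1, h⟩))).val
    · rw [if_pos h1, h1.neg_one_pow]
      ring
    · rw [if_neg h1, (Nat.not_odd_iff_even.1 h1).neg_one_pow]
      ring
  · have hs : Q.act f z = z := by rw [act, dif_neg h]
    rw [hs]
    simp only [MarkedIdx, h, not_false_eq_true, true_and, dif_neg]
    ring

/-- The reflection in the uniform state. -/
theorem exists_unitary_diffusion :
    ∃ W ∈ Matrix.unitaryGroup (Fin (2 ^ Q.m)) ℂ, ∀ c,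
      W.mulVec (Q.tens c Q.signState) =
        Q.tens (fun i => 2 / 2 ^ Q.mi * (∑ j, c j) - c i) Q.signState := by
  set u : Fin (2 ^ Q.mi) → ℂ := fun _ => ((√(2 ^ Q.mi : ℝ))⁻¹ : ℝ) with hu
  have hsq : (((√(2 ^ Q.mi : ℝ))⁻¹ : ℝ) : ℂ) * ((√(2 ^ Q.mi : ℝ))⁻¹ : ℝ) = (2 ^ Q.mi)⁻¹ := by
    rw [← Complex.ofReal_mul, ← mul_inv, Real.mul_self_sqrt (by positivity)]
    push_cast
    rfl
  have hu1 : ∑ i, ‖u i‖ ^ 2 = 1 := by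
    simp only [hu]
    rw [Finset.sum_const, Complex.norm_real, Real.norm_of_nonneg (by positivity), inv_pow,
      Real.sq_sqrt (by positivity)]
    simp
  have hψ : ∑ z, ‖Q.tens u Q.signState z‖ ^ 2 = 1 := by
    rw [sum_norm_sq_tens, hu1, sum_norm_sq_signState, one_mul]
  refine ⟨_, reflection_mem_unitary _ hψ, fun c => ?_⟩
  rw [Matrix.sub_mulVec, Matrix.smul_mulVec, Matrix.vecMulVec_mulVec, Matrix.one_mulVec,
    star_tens_dotProduct, star_dotProduct_self_eq, sum_norm_sq_signState]
  have h1 : star u ⬝ᵥ c = ((√(2 ^ Q.mi : ℝ))⁻¹ : ℝ) * ∑ j, c j := by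
    simp [dotProduct, hu, Finset.mul_sum]
  rw [h1]
  ext z
  simp only [Pi.sub_apply, Pi.smul_apply, tens, smul_eq_mul, MulOpposite.smul_eq_mul_unop,
    MulOpposite.unop_op, hu, Complex.ofReal_one, mul_one]
  rw [div_eq_mul_inv, ← hsq]
  ring

open Classical in
/-- The amplitudes of the indices at angle `φ`, if the initial angle is `θ`. -/
def groverCoef (T : Set (Fin (2 ^ Q.mi))) (f : D → K) (θ φ : ℝ) (i : Fin (2 ^ Q.mi)) : ℂ :=
  ((√(2 ^ Q.mi : ℝ))⁻¹ *
    if Q.MarkedIdx T f i then Real.sin φ / Real.sin θ else Real.cos φ / Real.cos θ : ℝ)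

/-- The initial angle of the Grover iteration. -/
def groverAngle (T : Set (Fin (2 ^ Q.mi))) (f : D → K) : ℝ :=
  Real.arcsin √(Q.numMarked T f / 2 ^ Q.mi)

variable {Q} {T : Set (Fin (2 ^ Q.mi))} {f : D → K}

theorem sin_sq_groverAngle (h : Q.numMarked T f < 2 ^ Q.mi) :
    Real.sin (Q.groverAngle T f) = √(Q.numMarked T f / 2 ^ Q.mi) := by
  have h2 : (Q.numMarked T f : ℝ) / 2 ^ Q.mi ≤ 1 := by
    rw [div_le_one (by positivity)]
    exact_mod_cast h.le
  rw [groverAngle, Real.sin_arcsin (le_trans (by norm_num) (Real.sqrt_nonneg _))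
    (Real.sqrt_le_one.2 h2)]

theorem sin_groverAngle_pos (h0 : 0 < Q.numMarked T f) (h : Q.numMarked T f < 2 ^ Q.mi) :
    0 < Real.sin (Q.groverAngle T f) := by
  rw [sin_sq_groverAngle h]
  exact Real.sqrt_pos.2 (by positivity)

theorem cos_groverAngle_pos (h : Q.numMarked T f < 2 ^ Q.mi) :
    0 < Real.cos (Q.groverAngle T f) := by
  rw [groverAngle, Real.cos_arcsin]
  refine Real.sqrt_pos.2 ?_
  rw [Real.sq_sqrt (by positivity), sub_pos, div_lt_one (by positivity)]
  exact_mod_cast h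

-- With `M = 2 ^ mi` there are `M sin² θ` marked and `M cos² θ` unmarked indices, so the signed sum
-- is `√M (cos θ cos φ - sin θ sin φ)`.
open Classical in
theorem sum_flip_groverCoef (h0 : 0 < Q.numMarked T f) (h : Q.numMarked T f < 2 ^ Q.mi) (φ : ℝ) :
    ∑ i, (if Q.MarkedIdx T f i then -1 else 1) * Q.groverCoef T f (Q.groverAngle T f) φ i =
      (√(2 ^ Q.mi : ℝ) * Real.cos (Q.groverAngle T f + φ) : ℝ) := by
  set θ := Q.groverAngle T f with hθ
  have hs := sin_groverAngle_pos h0 h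
  have hc := cos_groverAngle_pos h
  rw [← hθ] at hs hc
  have hM : (0 : ℝ) < 2 ^ Q.mi := by positivity
  have hK : (Q.numMarked T f : ℝ) = 2 ^ Q.mi * Real.sin θ ^ 2 := by
    rw [sin_sq_groverAngle h, Real.sq_sqrt (by positivity)]
    field_simp
  have hK' : ((Finset.univ.filter fun i => ¬ Q.MarkedIdx T f i).card : ℝ) =
      2 ^ Q.mi * Real.cos θ ^ 2 := by
    have h1 := Finset.card_filter_add_card_filter_not (s := (Finset.univ : Finset (Fin (2 ^ Q.mi))))
      (fun i => Q.MarkedIdx T f i)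
    rw [Finset.card_univ, Fintype.card_fin] at h1
    have h2 : (Q.numMarked T f : ℝ) +
        ((Finset.univ.filter fun i => ¬ Q.MarkedIdx T f i).card : ℝ) = 2 ^ Q.mi := by
      exact_mod_cast h1
    rw [Real.cos_sq']
    linarith
  have h1 : ∀ i, (if Q.MarkedIdx T f i then (-1 : ℂ) else 1) * Q.groverCoef T f θ φ i =
      (((√(2 ^ Q.mi : ℝ))⁻¹ * if Q.MarkedIdx T f i then -(Real.sin φ / Real.sin θ)
        else Real.cos φ / Real.cos θ : ℝ) : ℂ) := by
    intro i
    unfold groverCoef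
    split_ifs <;> push_cast <;> ring
  simp only [h1]
  rw [← Complex.ofReal_sum, ← Finset.mul_sum, Finset.sum_ite, Finset.sum_const, Finset.sum_const,
    nsmul_eq_mul, nsmul_eq_mul, hK']
  change (((√(2 ^ Q.mi : ℝ))⁻¹ * ((Q.numMarked T f : ℝ) * _ + _) : ℝ) : ℂ) = _
  rw [hK, Real.cos_add]
  congr 1
  have hM2 : √(2 ^ Q.mi : ℝ) ^ 2 = 2 ^ Q.mi := Real.sq_sqrt hM.le
  have hM3 : 0 < √(2 ^ Q.mi : ℝ) := Real.sqrt_pos.2 hM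
  set s := √(2 ^ Q.mi : ℝ)
  rw [← hM2]
  field_simp
  ring

/-- The state after `j` Grover iterations. -/
theorem reach_grover (z₀ : Fin (2 ^ Q.m))
    (hT : ∀ f, 0 < Q.numMarked T f ∧ Q.numMarked T f < 2 ^ Q.mi) (j : ℕ) :
    Q.Reach z₀ j fun f => Q.tens (Q.groverCoef T f (Q.groverAngle T f)
      ((2 * j + 1) * Q.groverAngle T f)) Q.signState := by
  induction j with
  | zero =>
    have h1 : ∀ f, Q.groverCoef T f (Q.groverAngle T f)
        ((2 * (0 : ℕ) + 1) * Q.groverAngle T f) = fun _ => (((√(2 ^ Q.mi : ℝ))⁻¹ : ℝ) : ℂ) := by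
      intro f
      ext i
      have hs := sin_groverAngle_pos (hT f).1 (hT f).2
      have hc := cos_groverAngle_pos (hT f).2
      simp only [Nat.cast_zero, mul_zero, zero_add, one_mul, groverCoef]
      rw [div_self hs.ne', div_self hc.ne']
      simp
    simp only [h1]
    refine reach_zero _ ?_
    rw [sum_norm_sq_tens, sum_norm_sq_signState, Finset.sum_const, Complex.norm_real,
      Real.norm_of_nonneg (by positivity), inv_pow, Real.sq_sqrt (by positivity)]
    simp
  | succ j ih =>
    obtain ⟨W, hW, hWv⟩ := Q.exists_unitary_flip T
    obtain ⟨V, hV, hVv⟩ := Q.exists_unitary_diffusion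
    have h1 := (ih.query.mul hW).mul hV
    simp only [hWv, hVv] at h1
    convert h1 using 3 with f
    ext i
    rw [sum_flip_groverCoef (hT f).1 (hT f).2]
    set θ := Q.groverAngle T f with hθ
    have hs : 0 < Real.sin θ := sin_groverAngle_pos (hT f).1 (hT f).2
    have hc : 0 < Real.cos θ := cos_groverAngle_pos (hT f).2
    set φ := (2 * (j : ℝ) + 1) * θ with hφ
    -- Flip and diffusion together advance the angle by `2θ`. Both cases below are sum-to-product
    -- formulas for `φ + 2θ` and `φ`.
    have hφ' : (2 * ((j + 1 : ℕ) : ℝ) + 1) * θ = φ + 2 * θ := by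
      rw [hφ]; push_cast; ring
    rw [hφ']
    have hM : (0 : ℝ) < 2 ^ Q.mi := by positivity
    have hM3 : 0 < √(2 ^ Q.mi : ℝ) := Real.sqrt_pos.2 hM
    have hM2 : √(2 ^ Q.mi : ℝ) ^ 2 = 2 ^ Q.mi := Real.sq_sqrt hM.le
    have hM4 : (2 : ℂ) / 2 ^ Q.mi * (√(2 ^ Q.mi : ℝ) * Real.cos (θ + φ) : ℝ) =
        ((2 * (√(2 ^ Q.mi : ℝ))⁻¹ * Real.cos (θ + φ) : ℝ) : ℂ) := by
      have : (2 : ℝ) / 2 ^ Q.mi * (√(2 ^ Q.mi : ℝ) * Real.cos (θ + φ)) =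
        2 * (√(2 ^ Q.mi : ℝ))⁻¹ * Real.cos (θ + φ) := by
        nth_rw 1 [← hM2]
        field_simp
      rw [← this]
      push_cast
      ring
    rw [hM4]
    unfold groverCoef
    by_cases hm : Q.MarkedIdx T f i
    · simp only [hm, if_true]
      have : (√(2 ^ Q.mi : ℝ))⁻¹ * (Real.sin (φ + 2 * θ) / Real.sin θ) =
          2 * (√(2 ^ Q.mi : ℝ))⁻¹ * Real.cos (θ + φ) -
            -1 * ((√(2 ^ Q.mi : ℝ))⁻¹ * (Real.sin φ / Real.sin θ)) := by
        have e : Real.sin (φ + 2 * θ) = 2 * Real.cos (θ + φ) * Real.sin θ + Real.sin φ := by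
          rw [Real.sin_add, Real.cos_add, Real.sin_two_mul, Real.cos_two_mul]
          linear_combination (2 * Real.sin φ) * Real.sin_sq_add_cos_sq θ
        rw [e]
        field_simp
        ring
      rw [this]
      push_cast
      ring
    · simp only [hm, if_false]
      have : (√(2 ^ Q.mi : ℝ))⁻¹ * (Real.cos (φ + 2 * θ) / Real.cos θ) =
          2 * (√(2 ^ Q.mi : ℝ))⁻¹ * Real.cos (θ + φ) -
            1 * ((√(2 ^ Q.mi : ℝ))⁻¹ * (Real.cos φ / Real.cos θ)) := by
        have e : Real.cos (φ + 2 * θ) = 2 * Real.cos (θ + φ) * Real.cos θ - Real.cos φ := by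
          rw [Real.cos_add, Real.cos_add, Real.sin_two_mul, Real.cos_two_mul]
          ring
        rw [e]
        field_simp
      rw [this]
      push_cast
      ring

variable (Q) in
/-- An algorithm with `j + 1` queries that finds each marked index with the probability given by
`j` Grover iterations, together with the value there. -/
theorem exists_grover (T : Set (Fin (2 ^ Q.mi)))
    (hT : ∀ f, 0 < Q.numMarked T f ∧ Q.numMarked T f < 2 ^ Q.mi) (j : ℕ) :
    ∃ (A : PureAlgorithm D K) (z₀ : Fin (2 ^ A.m)) (idx : Fin (2 ^ A.m) → Fin (2 ^ Q.mi))
      (val : Fin (2 ^ A.m) → Fin (2 ^ Q.mv)), A.n = j + 1 ∧ ∀ f,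
      (∀ z (h : idx z ∈ Q.Z), A.mat f z z₀ ≠ 0 → val z = Q.β (f (Q.τ ⟨idx z, h⟩))) ∧
      (∀ i, Q.MarkedIdx T f i → ∃ z, idx z = i ∧ ‖A.mat f z z₀‖ ^ 2 =
        Real.sin ((2 * j + 1) * Q.groverAngle T f) ^ 2 / Q.numMarked T f) := by
  set z₀ : Fin (2 ^ Q.m) := 0 with hz₀
  -- The value register is rotated back to the basis state `0`, so that one extra query writes the
  -- value next to the index before the measurement.
  obtain ⟨H, hH⟩ := exists_unitary_to_single (0 : Fin (2 ^ Q.mv)) Q.signState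
    Q.sum_norm_sq_signState
  obtain ⟨W, hW, hWv⟩ := Q.exists_unitary_value H
  have h1 := ((reach_grover z₀ hT j).mul hW).query
  simp only [hWv, hH] at h1
  obtain ⟨U, hU⟩ := h1
  refine ⟨⟨Q, j + 1, U⟩, z₀, fun z => (Q.split z).1, fun z => (Q.split z).2.1, rfl, fun f => ?_⟩
  set c := Q.groverCoef T f (Q.groverAngle T f) ((2 * j + 1) * Q.groverAngle T f) with hc
  have h2 : ∀ z, alternate (Q.mat f) (j + 1) (fun j => (U j : Matrix _ _ ℂ)) (Q.act f z) z₀ =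
      Q.tens c (Pi.single 0 1) z := by
    intro z
    have := congrFun (hU f) (Q.act f z)
    beta_reduce at this
    rw [mat_mulVec_act, Adversary.alternate_single] at this
    exact (one_mul _).symm.trans this
  constructor
  · intro z' hz' hne
    change (Q.split z').1 ∈ Q.Z at hz'
    obtain ⟨z, rfl⟩ := Q.act_surjective f z'
    have h3 : Q.tens c (Pi.single 0 1) z ≠ 0 := by
      rw [← h2]; exact hne
    have h4 : (Q.split z).2.1 = 0 := by
      by_contra h
      exact h3 (by simp [tens, Pi.single_eq_of_ne h])
    have hz : (Q.split z).1 ∈ Q.Z := by rwa [split_act_fst] at hz'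
    have h5 : (Q.split (Q.act f z)).2.1 = Q.β (f (Q.τ ⟨(Q.split z).1, hz⟩)) := by
      rw [Q.split_act_of_mem f hz, h4, zero_add]
    have h6 : (⟨(Q.split (Q.act f z)).1, hz'⟩ : Q.Z) = ⟨(Q.split z).1, hz⟩ :=
      Subtype.ext (Q.split_act_fst f z)
    exact h5.trans (congrArg (fun w => Q.β (f (Q.τ w))) h6.symm)
  · intro i hi
    refine ⟨Q.act f (Q.split.symm (i, 0, 0)), ?_, ?_⟩
    · change (Q.split (Q.act f (Q.split.symm (i, 0, 0)))).1 = i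
      rw [split_act_fst, Equiv.apply_symm_apply]
    · change ‖alternate (Q.mat f) (j + 1) (fun j => (U j : Matrix _ _ ℂ)) _ z₀‖ ^ 2 = _
      rw [h2]
      simp only [tens, Equiv.apply_symm_apply, Pi.single_eq_same, mul_one, if_true]
      rw [hc, groverCoef, if_pos hi, Complex.norm_real, Real.norm_eq_abs, sq_abs, mul_pow,
        div_pow, inv_pow, Real.sq_sqrt (by positivity), sin_sq_groverAngle (hT f).2,
        Real.sq_sqrt (by positivity)]
      have := (hT f).1
      field_simp

end Query

/-! ### Independent repetitions -/

section Repeat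

variable {D K G : Type*}

/-- The algorithm that runs `A` from the start state `z₀` independently `R` times. -/
def PureAlgorithm.repeated (A : PureAlgorithm D K) (z₀ : Fin (2 ^ A.m)) {R : ℕ} (hR : 1 ≤ R)
    (φ : (Fin R → Fin (2 ^ A.m)) → G) : Algorithm D K G where
  k := R
  k_pos := hR
  A := fun _ => A
  b := fun _ _ => z₀
  φ := φ

variable (A : PureAlgorithm D K) (z₀ : Fin (2 ^ A.m)) {R : ℕ} (hR : 1 ≤ R)
  (φ : (Fin R → Fin (2 ^ A.m)) → G)

theorem repeated_queries : (A.repeated z₀ hR φ).queries = R * A.n := by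
  change ∑ _l : Fin R, A.n = R * A.n
  simp

open Classical in
/-- The probability that one of several results, each of probability at least `ρ`, does not occur
in `R` repetitions. -/
theorem sum_missing_le {ι : Type*} (f : D → K) (s : Finset ι) (z : ι → Fin (2 ^ A.m)) {ρ : ℝ}
    (h : ∀ i ∈ s, ρ ≤ ‖A.mat f (z i) z₀‖ ^ 2) :
    ∑ x : Fin R → Fin (2 ^ A.m), (if ∃ i ∈ s, ∀ l, x l ≠ z i then
      ∏ l, ‖A.mat f (x l) z₀‖ ^ 2 else 0) ≤ s.card * (1 - ρ) ^ R := by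
  have h1 : ∀ x : Fin R → Fin (2 ^ A.m), (if ∃ i ∈ s, ∀ l, x l ≠ z i then
      ∏ l, ‖A.mat f (x l) z₀‖ ^ 2 else 0) ≤
      ∑ i ∈ s, ∏ l, (if x l = z i then 0 else ‖A.mat f (x l) z₀‖ ^ 2) := by
    intro x
    have h0 : ∀ i, 0 ≤ ∏ l, (if x l = z i then 0 else ‖A.mat f (x l) z₀‖ ^ 2) := fun i =>
      Finset.prod_nonneg fun l _ => by split_ifs <;> positivity
    split_ifs with hx
    · obtain ⟨i, hi, hx⟩ := hx
      refine le_trans (le_of_eq ?_) (Finset.single_le_sum (fun i _ => h0 i) hi)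
      exact Finset.prod_congr rfl fun l _ => by rw [if_neg (hx l)]
    · exact Finset.sum_nonneg fun i _ => h0 i
  refine (Finset.sum_le_sum fun x _ => h1 x).trans ?_
  rw [Finset.sum_comm, ← nsmul_eq_mul]
  refine Finset.sum_le_card_nsmul _ _ _ fun i hi => ?_
  rw [← Fintype.sum_pow (fun y => if y = z i then 0 else ‖A.mat f y z₀‖ ^ 2) R]
  have h2 : ∑ y, (if y = z i then 0 else ‖A.mat f y z₀‖ ^ 2) = 1 - ‖A.mat f (z i) z₀‖ ^ 2 := by
    have h3 : ∀ y, (if y = z i then 0 else ‖A.mat f y z₀‖ ^ 2) =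
        ‖A.mat f y z₀‖ ^ 2 - if y = z i then ‖A.mat f y z₀‖ ^ 2 else 0 := by
      intro y; split_ifs <;> simp
    simp only [h3]
    rw [Finset.sum_sub_distrib, A.sum_norm_sq, Finset.sum_ite_eq' Finset.univ (z i)]
    simp
  refine pow_le_pow_left₀ (Finset.sum_nonneg fun y _ => by split_ifs <;> positivity) ?_ R
  rw [h2]
  linarith [h i hi]

end Repeat

/-! ### Parameters of the search -/

/-- Jordan's inequality `2y/π ≤ sin y` gives `sin y ≥ 1/π` on `[1/2, π/2]`, and `π² < 10`; the rest
is the symmetry about `π/2`. -/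
theorem one_div_ten_le_sin_sq {x : ℝ} (h1 : 1 / 2 ≤ x) (h2 : x ≤ Real.pi - 1 / 2) :
    1 / 10 ≤ Real.sin x ^ 2 := by
  have hπ := Real.pi_gt_three
  have hπ' := Real.pi_lt_d2
  have key : ∀ y : ℝ, 1 / 2 ≤ y → y ≤ Real.pi / 2 → 1 / 10 ≤ Real.sin y ^ 2 := by
    intro y hy1 hy2
    have h3 : 1 / Real.pi ≤ Real.sin y := by
      refine le_trans ?_ (Real.mul_le_sin (by linarith) hy2)
      rw [div_mul_eq_mul_div]
      gcongr
      linarith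
    have h4 : (1 / Real.pi) ^ 2 ≤ Real.sin y ^ 2 := by gcongr
    refine le_trans ?_ h4
    rw [div_pow, one_pow]
    refine one_div_le_one_div_of_le (by positivity) ?_
    nlinarith
  by_cases hx : x ≤ Real.pi / 2
  · exact key x h1 hx
  · rw [← Real.sin_pi_sub]
    exact key _ (by linarith) (by linarith)

/-- The number of Grover iterations that suits all numbers of marked points between `K₀` and
`2 K₀`. -/
theorem exists_iterations {r : ℝ} (hr : 0 < r) (hr4 : r ≤ 1 / 4) :
    ∃ j : ℕ, ((j : ℝ) + 1 ≤ 1 / r) ∧ ∀ θ : ℝ, 0 ≤ θ → θ ≤ Real.pi / 2 → r ≤ Real.sin θ →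
      Real.sin θ ^ 2 ≤ 2 * r ^ 2 → 1 / 10 ≤ Real.sin ((2 * j + 1) * θ) ^ 2 := by
  have h4 : 4 ≤ 1 / r := by
    rw [le_div_iff₀ hr]; linarith
  -- This makes `1/r - 2 < 2j + 1 ≤ 1/r`, so that `(2j + 1) r` lies in `[1/2, 1]`.
  set j := ⌊1 / (2 * r) - 1 / 2⌋₊ with hj
  have hpos : 0 ≤ 1 / (2 * r) - 1 / 2 := by
    have : 1 / (2 * r) = 1 / r / 2 := by field_simp
    rw [this]; linarith
  have h5 : (j : ℝ) ≤ 1 / (2 * r) - 1 / 2 := Nat.floor_le hpos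
  have h6 : 1 / (2 * r) - 1 / 2 < j + 1 := Nat.lt_floor_add_one _
  have h7 : 1 / (2 * r) = 1 / r / 2 := by field_simp
  rw [h7] at h5 h6
  refine ⟨j, by linarith, fun θ h0 hθ h1 h2 => ?_⟩
  have hπ := Real.pi_gt_three
  have h8 : r ≤ θ := h1.trans (Real.sin_le h0)
  have h9 : θ ≤ Real.pi / 2 * Real.sin θ := by
    have := Real.mul_le_sin h0 hθ
    have h10 : Real.pi / 2 * (2 / Real.pi * θ) = θ := by field_simp
    calc θ = Real.pi / 2 * (2 / Real.pi * θ) := h10.symm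
      _ ≤ _ := mul_le_mul_of_nonneg_left this (by positivity)
  -- `71/50` exceeds `√2`, yet still keeps `(2j + 1) θ` at most `0.71 π`, which is below `π - 1/2`.
  have h10 : Real.sin θ ≤ 71 / 50 * r := by
    refine abs_le_of_sq_le_sq' ?_ (by positivity) |>.2
    nlinarith
  have h11 : 1 / 2 ≤ (2 * (j : ℝ) + 1) * r := by
    have : (1 / r - 2) * r ≤ (2 * (j : ℝ) + 1) * r := by
      refine mul_le_mul_of_nonneg_right ?_ hr.le
      linarith
    have e : (1 / r - 2) * r = 1 - 2 * r := by field_simp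
    rw [e] at this
    linarith
  have h12 : (2 * (j : ℝ) + 1) * r ≤ 1 := by
    have : (2 * (j : ℝ) + 1) * r ≤ (1 / r) * r := by
      refine mul_le_mul_of_nonneg_right ?_ hr.le
      linarith
    rwa [one_div_mul_cancel hr.ne'] at this
  have hj0 : (0 : ℝ) ≤ 2 * j + 1 := by positivity
  refine one_div_ten_le_sin_sq ?_ ?_
  · exact h11.trans (mul_le_mul_of_nonneg_left h8 hj0)
  · have h13 : (2 * (j : ℝ) + 1) * θ ≤ (2 * j + 1) * (Real.pi / 2 * (71 / 50 * r)) := by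
      refine mul_le_mul_of_nonneg_left (h9.trans ?_) hj0
      gcongr
    have h14 : (2 * (j : ℝ) + 1) * (Real.pi / 2 * (71 / 50 * r)) =
        Real.pi * (71 / 100) * ((2 * j + 1) * r) := by ring
    rw [h14] at h13
    nlinarith

/-- A finite encoding of the reals in `[-b, b]` with accuracy `t`, whose parity tells whether the
absolute value is at least `t`. -/
theorem exists_encoding {b t : ℝ} (ht : 0 < t) :
    ∃ (ν : ℕ) (β : ℝ → Fin (2 ^ ν)) (dec : Fin (2 ^ ν) → ℝ), 1 ≤ ν ∧ ∀ y, |y| ≤ b →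
      (Odd (β y).val ↔ t ≤ |y|) ∧ |y - dec (β y)| ≤ t := by
  classical
  obtain ⟨L, hL⟩ := exists_nat_gt (2 * b / t)
  set ν := 2 * L + 2 with hν
  have hν2 : 2 * L + 2 < 2 ^ ν := Nat.lt_two_pow_self
  -- The last bit is the flag for Grover's sign, the other bits are the rounded value. For `|y| ≤ b`
  -- the code is below `2 ^ ν`, so nothing wraps around.
  set code : ℝ → ℕ := fun y => 2 * ⌊(y + b) / t⌋₊ + if t ≤ |y| then 1 else 0 with hcode
  refine ⟨ν, fun y => Fin.ofNat (2 ^ ν) (code y), fun c => (c.val / 2 : ℕ) * t - b, by omega, ?_⟩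
  intro y hy
  obtain ⟨hy1, hy2⟩ := abs_le.1 hy
  have h0 : 0 ≤ (y + b) / t := div_nonneg (by linarith) ht.le
  have h1 : ⌊(y + b) / t⌋₊ ≤ L := by
    refine Nat.floor_le_of_le (le_trans ?_ hL.le)
    gcongr
    linarith
  have h2 : code y < 2 ^ ν := by
    simp only [hcode]
    split_ifs <;> omega
  have h3 : (Fin.ofNat (2 ^ ν) (code y)).val = code y := by
    rw [Fin.val_ofNat, Nat.mod_eq_of_lt h2]
  have h4 : code y / 2 = ⌊(y + b) / t⌋₊ := by
    simp only [hcode]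
    split_ifs <;> omega
  beta_reduce
  rw [h3, h4]
  constructor
  · simp only [hcode]
    split_ifs with h
    · simp [h]
    · simp [h]
  · have h5 := Nat.floor_le h0
    have h6 := Nat.lt_floor_add_one ((y + b) / t)
    rw [le_div_iff₀ ht] at h5
    rw [div_lt_iff₀ ht] at h6
    rw [abs_le]
    constructor <;> nlinarith

/-! ### The upper bound -/

theorem embedError_le (p q : ℝ≥0∞) [Fact (1 ≤ q)] {n N : ℕ} {ε : ℝ} (hε : 0 ≤ ε)
    (A : Algorithm (Fin N) ℝ (LpN q N)) (hA : A.queries ≤ n)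
    (h : ∀ f : Fin N → ℝ, ‖LpN.of p N f‖ ≤ 1 →
      A.outputProb f {g | ε < ‖LpN.of q N f - g‖} ≤ 1 / 4) :
    embedError p q n N ≤ ENNReal.ofReal ε := by
  unfold embedError minError minErrorWith
  refine iInf₂_le_of_le A hA (iSup_le fun f => ?_)
  refine iInf₂_le_of_le ε.toNNReal ?_ le_rfl
  rw [Real.coe_toNNReal _ hε]
  exact h f f.2

/-- The algorithm that makes no query and returns `0`. -/
theorem embedError_le_of_norm_le (p q : ℝ≥0∞) [Fact (1 ≤ q)] {n N : ℕ} (hN : 1 ≤ N) {ε : ℝ}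
    (hε : 0 ≤ ε) (h : ∀ f : Fin N → ℝ, ‖LpN.of p N f‖ ≤ 1 → ‖LpN.of q N f‖ ≤ ε) :
    embedError p q n N ≤ ENNReal.ofReal ε := by
  have : NeZero N := ⟨by omega⟩
  let Q : Query (Fin N) ℝ :=
    { m := 2, mi := 1, mv := 1, mi_pos := le_rfl, mv_pos := le_rfl, le := le_rfl,
      Z := Set.univ, Z_nonempty := Set.univ_nonempty, τ := fun _ => 0, β := fun _ => 0 }
  let P : PureAlgorithm (Fin N) ℝ := { Q := Q, n := 0, U := fun _ => 1 }
  let A : Algorithm (Fin N) ℝ (LpN q N) := P.repeated (0 : Fin (2 ^ 2)) le_rfl (fun _ => 0)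
  refine embedError_le p q hε A ?_ fun f hf => ?_
  · exact (repeated_queries P _ le_rfl _).le.trans (by simp [P])
  · classical
    refine le_trans (le_of_eq (Finset.sum_eq_zero fun x _ => ?_)) (by norm_num : (0 : ℝ) ≤ 1 / 4)
    rw [if_neg]
    intro hx
    have h1 : ε < ‖LpN.of q N f - 0‖ := hx
    rw [sub_zero] at h1
    exact absurd (h f hf) (not_le.2 h1)

/-- The query for the search among the values of a function on `{0, …, N-1}`. -/
def searchQuery {N μ ν : ℕ} (hN : 1 ≤ N) (hμ : 1 ≤ μ) (hν : 1 ≤ ν) (β : ℝ → Fin (2 ^ ν)) :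
    Query (Fin N) ℝ where
  m := μ + ν
  mi := μ
  mv := ν
  mi_pos := hμ
  mv_pos := hν
  le := le_rfl
  Z := {i | i.val < N}
  Z_nonempty := ⟨0, hN⟩
  τ := fun i => ⟨i.1.val, i.2⟩
  β := β

theorem Query.card_le_numMarked {D K : Type*} {Q : Query D K} {T : Set (Fin (2 ^ Q.mi))}
    {f : D → K} {s : Finset (Fin (2 ^ Q.mi))} (h : ∀ i ∈ s, Q.MarkedIdx T f i) :
    s.card ≤ Q.numMarked T f := by
  classical
  unfold Query.numMarked
  exact Finset.card_le_card fun i hi => Finset.mem_filter.2 ⟨Finset.mem_univ i, h i hi⟩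

/-! ### Counting the marked indices of the search, dummies included. -/

section Search

variable {N μ ν K₀ : ℕ} (hN : 1 ≤ N) (hμ : 1 ≤ μ) (hν : 1 ≤ ν) (β : ℝ → Fin (2 ^ ν))

theorem markedIdx_searchQuery_iff (f : Fin N → ℝ) (i : Fin (2 ^ μ)) :
    (searchQuery hN hμ hν β).MarkedIdx {i | N ≤ i.val ∧ i.val < N + K₀} f i ↔
      (∃ h : i.val < N, Odd (β (f ⟨i.val, h⟩)).val) ∨ (N ≤ i.val ∧ i.val < N + K₀) := by
  unfold Query.MarkedIdx
  split_ifs with h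
  · have h' : i.val < N := h
    constructor
    · intro h1; exact Or.inl ⟨h', h1⟩
    · rintro (⟨_, h1⟩ | h1)
      · exact h1
      · omega
  · have h' : ¬ i.val < N := h
    constructor
    · intro h1; exact Or.inr h1
    · rintro (⟨h1, _⟩ | h1)
      · exact absurd h1 h'
      · exact h1

theorem le_numMarked_searchQuery (hM : N + K₀ < 2 ^ μ) (f : Fin N → ℝ) :
    K₀ ≤ (searchQuery hN hμ hν β).numMarked {i | N ≤ i.val ∧ i.val < N + K₀} f := by
  classical
  have h1 : (Finset.univ.image fun a : Fin K₀ => (⟨N + a.val, by omega⟩ : Fin (2 ^ μ))).card =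
      K₀ := by
    rw [Finset.card_image_of_injective, Finset.card_univ, Fintype.card_fin]
    intro a b hab
    simp only [Fin.mk.injEq, Nat.add_left_cancel_iff] at hab
    exact Fin.ext hab
  refine h1.symm.le.trans (Query.card_le_numMarked (Q := searchQuery hN hμ hν β) fun i hi => ?_)
  obtain ⟨a, -, rfl⟩ := Finset.mem_image.1 hi
  exact (markedIdx_searchQuery_iff hN hμ hν β f _).2
    (Or.inr ⟨Nat.le_add_right _ _, Nat.add_lt_add_left a.2 _⟩)

theorem numMarked_searchQuery_le (hM : N + K₀ < 2 ^ μ) (f : Fin N → ℝ) (s : Finset (Fin N))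
    (hs : ∀ i, Odd (β (f i)).val → i ∈ s) :
    (searchQuery hN hμ hν β).numMarked {i | N ≤ i.val ∧ i.val < N + K₀} f ≤ s.card + K₀ := by
  classical
  have h1 : (Finset.univ.image fun a : Fin K₀ => (⟨N + a.val, by omega⟩ : Fin (2 ^ μ))).card ≤
      K₀ := Finset.card_image_le.trans (by simp)
  have h2 : (s.image fun a : Fin N => (⟨a.val, by omega⟩ : Fin (2 ^ μ))).card ≤ s.card :=
    Finset.card_image_le
  refine le_trans ?_ (add_le_add h2 h1)
  refine le_trans (Finset.card_le_card fun i hi => ?_) (Finset.card_union_le _ _)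
  have hi' := (markedIdx_searchQuery_iff hN hμ hν β f i).1 (Finset.mem_filter.1 hi).2
  rcases hi' with ⟨h, h3⟩ | ⟨h3, h4⟩
  · exact Finset.mem_union_left _ (Finset.mem_image.2 ⟨⟨i.val, h⟩, hs _ h3, rfl⟩)
  · refine Finset.mem_union_right _ (Finset.mem_image.2 ⟨⟨i.val - N, by omega⟩,
      Finset.mem_univ _, ?_⟩)
    apply Fin.ext
    change N + (i.val - N) = i.val
    omega

end Search

open Classical in
/-- The error of the algorithm that finds all large values by Grover search. -/
theorem embedError_le_of_search (p q : ℝ≥0∞) [hp : Fact (1 ≤ p)] [Fact (1 ≤ q)] (hpq : p < q)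
    {n N K₀ : ℕ} (hN : 1 ≤ N) (hK : 1 ≤ K₀) (hKN : K₀ ≤ N)
    (hn : 120 * Real.log (4 * N) * √((N : ℝ) * K₀) ≤ n) :
    embedError p q n N ≤
      ENNReal.ofReal (((N / K₀ : ℝ) ^ (1 / p.toReal)) ^ (1 - p.toReal / q.toReal)) := by
  have hp1 := hp.out
  have hpt : p ≠ ∞ := hpq.ne_top
  have hp0 := LpN.toReal_pos_of_one_le hp1 hpt
  have hN0 : (0 : ℝ) < N := by exact_mod_cast hN
  have hK0 : (1 : ℝ) ≤ K₀ := by exact_mod_cast hK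
  have hKN0 : (K₀ : ℝ) ≤ N := by exact_mod_cast hKN
  set t : ℝ := (N / K₀ : ℝ) ^ (1 / p.toReal) with ht
  have ht0 : 0 < t := by positivity
  obtain ⟨ν, β, dec, hν, hβ⟩ := exists_encoding (b := (N : ℝ) ^ (1 / p.toReal)) (t := t) ht0
  -- Then `16 N < 2 ^ μ ≤ 32 N`, which leaves room for `K₀` dummy indices from `N` on and gives `r ≤
  -- 1/4` below.
  set μ := Nat.log 2 N + 5 with hμdef
  have hμ : 1 ≤ μ := by omega
  have hM1 : 16 * N < 2 ^ μ := by
    have h := Nat.lt_pow_succ_log_self (b := 2) (by norm_num) N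
    rw [hμdef, pow_add]
    rw [Nat.succ_eq_add_one, pow_succ] at h
    omega
  have hM2 : 2 ^ μ ≤ 32 * N := by
    have h := Nat.pow_log_le_self 2 (x := N) (by omega)
    rw [hμdef, pow_add]
    omega
  have hM1' : 16 * (N : ℝ) ≤ 2 ^ μ := by exact_mod_cast hM1.le
  have hM2' : (2 : ℝ) ^ μ ≤ 32 * N := by exact_mod_cast hM2
  have hNK : N + K₀ < 2 ^ μ := by omega
  set Q := searchQuery hN hμ hν β with hQ
  set T : Set (Fin (2 ^ μ)) := {i | N ≤ i.val ∧ i.val < N + K₀} with hT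
  have hTM : ∀ f, 0 < Q.numMarked T f ∧ Q.numMarked T f < 2 ^ Q.mi := by
    intro f
    have h1 := le_numMarked_searchQuery hN hμ hν β hNK f
    have h2 := numMarked_searchQuery_le hN hμ hν β hNK f Finset.univ (fun i _ => Finset.mem_univ i)
    rw [Finset.card_univ, Fintype.card_fin] at h2
    exact ⟨lt_of_lt_of_le hK h1, lt_of_le_of_lt h2 hNK⟩
  set r : ℝ := √((K₀ : ℝ) / 2 ^ μ) with hr
  have hr0 : 0 < r := Real.sqrt_pos.2 (by positivity)
  have hr2 : r ^ 2 = (K₀ : ℝ) / 2 ^ μ := Real.sq_sqrt (by positivity)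
  have hr4 : r ≤ 1 / 4 := by
    refine Real.sqrt_le_iff.2 ⟨by norm_num, ?_⟩
    rw [div_le_iff₀ (by positivity)]
    linarith
  obtain ⟨j, hj, hjθ⟩ := exists_iterations hr0 hr4
  obtain ⟨A, z₀, idx, val, hAn, hA⟩ := Q.exists_grover T hTM j
  have hlog : 1 ≤ Real.log (4 * N) := by
    rw [Real.le_log_iff_exp_le (by positivity)]
    have : (1 : ℝ) ≤ N := by exact_mod_cast hN
    have := Real.exp_one_lt_d9
    linarith
  -- One run finds a given large index with probability at least `(1/10) / (2 K₀)`; `R` runs then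
  -- miss it with probability at most `1 / (4N)`, and a union bound gives `1/4`.
  set R := ⌈20 * K₀ * Real.log (4 * N)⌉₊ with hR
  have hR1 : 20 * K₀ * Real.log (4 * N) ≤ R := Nat.le_ceil _
  have hR2 : (R : ℝ) ≤ 21 * K₀ * Real.log (4 * N) := by
    have h1 := Nat.ceil_lt_add_one (a := 20 * (K₀ : ℝ) * Real.log (4 * N)) (by positivity)
    nlinarith
  have hR0 : 1 ≤ R := by
    have : (0 : ℝ) < R := lt_of_lt_of_le (by positivity) hR1
    exact_mod_cast this
  set φ : (Fin R → Fin (2 ^ A.m)) → LpN q N := fun x => LpN.of q N fun i =>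
    if h : ∃ l, (idx (x l)).val = i.val ∧ Odd (val (x l)).val then dec (val (x h.choose)) else 0
    with hφ
  refine embedError_le p q (by positivity) (A.repeated z₀ hR0 φ) ?_ fun f hf => ?_
  · rw [repeated_queries, hAn]
    have h1 : ((R * (j + 1) : ℕ) : ℝ) ≤ n := by
      push_cast
      have h2 : 1 / r ≤ √(32 * N / K₀) := by
        rw [hr, one_div, ← Real.sqrt_inv, inv_div]
        gcongr
      -- `40/7` exceeds `√32` and makes the total constant `21 * 40/7 = 120`.
      have h3 : K₀ * √(32 * N / K₀ : ℝ) ≤ 40 / 7 * √((N : ℝ) * K₀) := by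
        refine abs_le_of_sq_le_sq' ?_ (by positivity) |>.2
        rw [mul_pow, mul_pow, Real.sq_sqrt (by positivity), Real.sq_sqrt (by positivity)]
        have : (K₀ : ℝ) ^ 2 * (32 * N / K₀) = 32 * (N * K₀) := by field_simp
        rw [this]
        have : 0 < (N : ℝ) * K₀ := by positivity
        nlinarith
      calc (R : ℝ) * (j + 1) ≤ (21 * K₀ * Real.log (4 * N)) * √(32 * N / K₀) := by
            refine mul_le_mul hR2 (hj.trans h2) (by positivity) (by positivity)
        _ = 21 * Real.log (4 * N) * (K₀ * √(32 * N / K₀)) := by ring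
        _ ≤ 21 * Real.log (4 * N) * (40 / 7 * √((N : ℝ) * K₀)) := by gcongr
        _ = 120 * Real.log (4 * N) * √((N : ℝ) * K₀) := by ring
        _ ≤ n := hn
    exact_mod_cast h1
  · have hfb : ∀ i, |f i| ≤ (N : ℝ) ^ (1 / p.toReal) := LpN.abs_le_of_norm_le_one hp1 hpt hN hf
    set s : Finset (Fin N) := Finset.univ.filter fun i => t ≤ |f i| with hs
    have hsmem : ∀ i, i ∈ s ↔ Odd (β (f i)).val := fun i => by
      rw [(hβ _ (hfb i)).1, hs, Finset.mem_filter]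
      simp
    have htp : t ^ p.toReal = N / K₀ := by
      rw [ht, ← Real.rpow_mul (by positivity), one_div_mul_cancel hp0.ne', Real.rpow_one]
    have hscard : s.card ≤ K₀ := by
      have h1 := LpN.card_mul_le hp1 hpt hN hf ht0.le
      rw [htp, mul_div_assoc', div_le_iff₀ (by positivity)] at h1
      have h2 : (s.card : ℝ) ≤ K₀ := by
        refine le_of_mul_le_mul_right ?_ hN0
        rw [mul_comm (K₀ : ℝ)]
        convert h1 using 3
      exact_mod_cast h2
    have hm1 : (K₀ : ℝ) ≤ Q.numMarked T f := by
      exact_mod_cast le_numMarked_searchQuery hN hμ hν β hNK f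
    have hm2 : (Q.numMarked T f : ℝ) ≤ 2 * K₀ := by
      have h1 := numMarked_searchQuery_le hN hμ hν β hNK f s (fun i hi => (hsmem i).2 hi)
      have h2 : Q.numMarked T f ≤ 2 * K₀ := by
        refine h1.trans ?_
        omega
      exact_mod_cast h2
    have hsin := Query.sin_sq_groverAngle (hTM f).2
    have hsq : Real.sin (Q.groverAngle T f) ^ 2 = Q.numMarked T f / 2 ^ μ := by
      rw [hsin, Real.sq_sqrt (by positivity)]
      rfl
    have hprob : 1 / 10 ≤ Real.sin ((2 * j + 1) * Q.groverAngle T f) ^ 2 := by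
      refine hjθ _ (Real.arcsin_nonneg.2 (Real.sqrt_nonneg _)) (Real.arcsin_le_pi_div_two _) ?_ ?_
      · rw [hsin]
        refine Real.sqrt_le_sqrt ?_
        change (K₀ : ℝ) / 2 ^ μ ≤ Q.numMarked T f / 2 ^ μ
        gcongr
      · rw [hsq, hr2, mul_div_assoc']
        gcongr
    obtain ⟨hA1, hA2⟩ := hA f
    have hmk : ∀ i : Fin N, i ∈ s → Q.MarkedIdx T f 
        ⟨i.val, lt_of_lt_of_le i.2 ((Nat.le_add_right N K₀).trans hNK.le)⟩ := by
      intro i hi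
      exact (markedIdx_searchQuery_iff hN hμ hν β f _).2 (Or.inl ⟨i.2, (hsmem i).1 hi⟩)
    have hz : ∀ i : Fin N, ∃ z, i ∈ s → (idx z).val = i.val ∧
        1 / (20 * K₀ : ℝ) ≤ ‖A.mat f z z₀‖ ^ 2 := by
      intro i
      by_cases hi : i ∈ s
      · obtain ⟨z, hz1, hz2⟩ := hA2 _ (hmk i hi)
        refine ⟨z, fun _ => ⟨by rw [hz1], ?_⟩⟩
        rw [hz2, div_le_div_iff₀ (by positivity) (by linarith)]
        nlinarith
      · exact ⟨z₀, fun h => absurd h hi⟩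
    choose z hz using hz
    have hmiss := sum_missing_le A z₀ (R := R) f s z (fun i hi => (hz i hi).2)
    have hbound : (s.card : ℝ) * (1 - 1 / (20 * K₀ : ℝ)) ^ R ≤ 1 / 4 := by
      have h1 : 1 - 1 / (20 * K₀ : ℝ) ≤ Real.exp (-(1 / (20 * K₀ : ℝ))) :=
        Real.one_sub_le_exp_neg _
      have h0 : 0 ≤ 1 - 1 / (20 * K₀ : ℝ) := by
        rw [sub_nonneg, div_le_one (by positivity)]
        linarith
      have h2 : (1 - 1 / (20 * K₀ : ℝ)) ^ R ≤ 1 / (4 * N) := by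
        refine (pow_le_pow_left₀ h0 h1 R).trans ?_
        rw [← Real.exp_nat_mul, one_div (4 * (N : ℝ)), ← Real.exp_log (inv_pos.2
          (by positivity : (0 : ℝ) < 4 * N)), Real.exp_le_exp, Real.log_inv, mul_neg, neg_le_neg_iff,
          mul_one_div, le_div_iff₀ (by positivity)]
        linarith
      have h3 : (s.card : ℝ) ≤ N := by
        have : (s.card : ℝ) ≤ K₀ := by exact_mod_cast hscard
        linarith
      calc (s.card : ℝ) * (1 - 1 / (20 * K₀ : ℝ)) ^ R ≤ N * (1 / (4 * N)) :=
            mul_le_mul h3 h2 (by positivity) hN0.le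
        _ = 1 / 4 := by field_simp
    refine le_trans ?_ (hmiss.trans hbound)
    change ∑ x : Fin R → Fin (2 ^ A.m), (if φ x ∈ {g | t ^ (1 - p.toReal / q.toReal) <
      ‖LpN.of q N f - g‖} then ∏ l, ‖A.mat f (x l) z₀‖ ^ 2 else 0) ≤ _
    refine Finset.sum_le_sum fun x _ => ?_
    have hprod : 0 ≤ ∏ l, ‖A.mat f (x l) z₀‖ ^ 2 := Finset.prod_nonneg fun l _ => by positivity
    by_cases hbad : ∃ i ∈ s, ∀ l, x l ≠ z i
    · rw [if_pos hbad]
      split_ifs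
      exacts [le_rfl, hprod]
    rw [if_neg hbad]
    -- Measured values are correct only at nonzero amplitude; result tuples of probability zero do
    -- not matter.
    by_cases hzero : ∏ l, ‖A.mat f (x l) z₀‖ ^ 2 = 0
    · rw [hzero]; simp
    rw [if_neg]
    have hval : ∀ l (i : Fin N), (idx (x l)).val = i.val → val (x l) = β (f i) := by
      intro l i hi
      have h1 : (idx (x l)).val < N := by rw [hi]; exact i.2
      have h2 : A.mat f (x l) z₀ ≠ 0 := by
        intro h
        exact hzero (Finset.prod_eq_zero (Finset.mem_univ l) (by rw [h]; simp))
      have h3 := hA1 (x l) h1 h2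
      have h4 : (⟨(idx (x l)).val, h1⟩ : Fin N) = i := Fin.ext hi
      rw [← h4]
      exact h3
    push Not at hbad
    simp only [Set.mem_ofPred_eq, not_lt, hφ]
    rw [← map_sub]
    -- At a found index the error is at most `t ≤ |f i|`, as certified by the odd parity. At the
    -- others the output is `0` and `|f i| < t`, since no large index was missed.
    refine LpN.norm_le_rpow hp1 hpq hN ht0 hf ?_ ?_ <;> intro i <;> simp only [Pi.sub_apply] <;>
      split_ifs with h
    · rw [hval _ i h.choose_spec.1]
      exact (hβ _ (hfb i)).2
    · rw [sub_zero]
      by_contra! h1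
      have his : i ∈ s := Finset.mem_filter.2 ⟨Finset.mem_univ i, h1.le⟩
      obtain ⟨l, hl⟩ := hbad i his
      have h2 : (idx (x l)).val = i.val := by rw [hl]; exact (hz i his).1
      exact h ⟨l, h2, by rw [hval l i h2]; exact (hsmem i).1 his⟩
    · have h1 := h.choose_spec
      rw [hval _ i h1.1] at h1 ⊢
      exact (hβ _ (hfb i)).2.trans ((hβ _ (hfb i)).1.1 h1.2)
    · rw [sub_zero]

/-! ### The order of the minimal error -/

theorem le_of_one_le_of_le {n N : ℕ} (hn : 1 ≤ n) (h : (n : ℝ) ≤ 1 / 3000 * N) : 3000 ≤ N := by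
  have h1 : (1 : ℝ) ≤ n := by exact_mod_cast hn
  have h2 : (3000 : ℝ) ≤ N := by linarith
  exact_mod_cast h2

/-- A constant fraction of all points carries spikes: blocks of length `16` with `k = ⌊N/16⌋ ≥
N/32`, for which `7/2048 * 4 k` exceeds `N/3000`. -/
theorem le_embedError_of_le (p q : ℝ≥0∞) [Fact (1 ≤ p)] [Fact (1 ≤ q)] {n N : ℕ} (hn : 1 ≤ n)
    (h : (n : ℝ) ≤ 1 / 3000 * N) (hpq : 1 / p.toReal - 1 / q.toReal ≤ 0) :
    ENNReal.ofReal (1 / 8 * (32 : ℝ) ^ (1 / p.toReal - 1 / q.toReal)) ≤ embedError p q n N := by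
  have hN := le_of_one_le_of_le hn h
  have hk : 1 ≤ N / 16 := by omega
  have hk32 : N ≤ 32 * (N / 16) := by omega
  have hk32' : (N : ℝ) ≤ 32 * (N / 16 : ℕ) := by exact_mod_cast hk32
  have hk0 : (0 : ℝ) < (N / 16 : ℕ) := by exact_mod_cast hk
  have h4 : √((16 : ℕ) : ℝ) = 4 := by
    rw [show ((16 : ℕ) : ℝ) = 4 ^ 2 by norm_num, Real.sqrt_sq (by norm_num)]
  refine le_trans ?_ (le_embedError p q (le_refl 16) hk (by omega) ?_)
  · refine ENNReal.ofReal_le_ofReal ?_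
    have h1 : (N : ℝ) / (N / 16 : ℕ) ≤ 32 := by
      rw [div_le_iff₀ hk0]; exact hk32'
    have h2 : (0 : ℝ) < (N : ℝ) / (N / 16 : ℕ) := by
      have : (0 : ℝ) < N := by exact_mod_cast (by omega : 0 < N)
      positivity
    exact mul_le_mul_of_nonneg_left (Real.rpow_le_rpow_of_nonpos h2 h1 hpq) (by norm_num)
  · rw [h4]
    linarith

theorem le_embedError_of_lt (p q : ℝ≥0∞) [Fact (1 ≤ p)] [Fact (1 ≤ q)] {n N : ℕ} (hn : 1 ≤ n)
    (h : (n : ℝ) ≤ 1 / 3000 * N) (hpq : 0 ≤ 1 / p.toReal - 1 / q.toReal) :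
    ENNReal.ofReal (1 / 8 * (1 / 400000 : ℝ) ^ (1 / p.toReal - 1 / q.toReal) *
      min (((N : ℝ) / n) ^ (2 * (1 / p.toReal - 1 / q.toReal)))
        ((N : ℝ) ^ (1 / p.toReal - 1 / q.toReal))) ≤ embedError p q n N := by
  have hN := le_of_one_le_of_le hn h
  have hN' : (3000 : ℝ) ≤ N := by exact_mod_cast hN
  have hN0 : (0 : ℝ) < N := by linarith
  have hn0 : (0 : ℝ) < n := by exact_mod_cast hn
  set a := 1 / p.toReal - 1 / q.toReal with ha
  -- Rounding `B = ⌊N/k⌋` costs at most a factor `2`, so `n^2 ≤ k^2 B / 100000`; this is below the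
  -- required bound because `(7/2048)^2 > 1/100000`.
  set y : ℝ := 200000 * n ^ 2 / N with hy
  have hy0 : 0 < y := by positivity
  set k := ⌈y⌉₊ with hk
  have hk1 : 1 ≤ k := Nat.one_le_ceil_iff.2 hy0
  have hky : y ≤ k := Nat.le_ceil y
  have hky' : (k : ℝ) < y + 1 := Nat.ceil_lt_add_one hy0.le
  have hyN : y ≤ N / 32 := by
    rw [hy, div_le_div_iff₀ hN0 (by norm_num)]
    nlinarith
  have hkN : (k : ℝ) ≤ N / 16 := by linarith
  have hk16 : 16 * k ≤ N := by
    have : (16 * k : ℝ) ≤ N := by linarith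
    exact_mod_cast this
  have hk0 : (0 : ℝ) < k := by exact_mod_cast hk1
  set B := N / k with hB
  have hB16 : 16 ≤ B := (Nat.le_div_iff_mul_le (by omega)).2 hk16
  have hNB : (N : ℝ) ≤ 2 * (k * B) := by
    have h1 : N < k * (B + 1) := Nat.lt_mul_div_succ N (by omega)
    have h2 : N ≤ 2 * (k * B) := by nlinarith
    exact_mod_cast h2
  refine le_trans ?_ (le_embedError p q hB16 hk1 (Nat.mul_div_le N k) ?_)
  · refine ENNReal.ofReal_le_ofReal ?_
    rw [mul_assoc]
    refine mul_le_mul_of_nonneg_left ?_ (by norm_num)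
    have h1 : ((N : ℝ) / n) ^ (2 * a) = (((N : ℝ) / n) ^ 2) ^ a := by
      rw [Real.rpow_mul (by positivity)]
      norm_num
    rw [h1, mul_min_of_nonneg _ _ (by positivity), ← Real.mul_rpow (by positivity) (by positivity),
      ← Real.mul_rpow (by positivity) (by positivity)]
    -- For `y ≤ 1` a single block remains, giving the second term of the minimum; otherwise `k ≤ 2y`
    -- gives the first, whence `400000`.
    rcases le_total y 1 with hy1 | hy1
    · refine (min_le_right _ _).trans (Real.rpow_le_rpow (by positivity) ?_ hpq)
      rw [le_div_iff₀ hk0]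
      nlinarith
    · refine (min_le_left _ _).trans (Real.rpow_le_rpow (by positivity) ?_ hpq)
      rw [le_div_iff₀ hk0]
      have h2 : (k : ℝ) ≤ 2 * y := by linarith
      calc 1 / 400000 * ((N : ℝ) / n) ^ 2 * (k : ℝ) ≤ 1 / 400000 * ((N : ℝ) / n) ^ 2 * (2 * y) := by
            gcongr
        _ = (N : ℝ) := by rw [hy]; field_simp; norm_num
  · refine lt_of_pow_lt_pow_left₀ 2 (by positivity) ?_
    rw [mul_pow, mul_pow, Real.sq_sqrt (Nat.cast_nonneg B)]
    have h1 : 200000 * (n : ℝ) ^ 2 ≤ k * N := by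
      rw [hy, div_le_iff₀ hN0] at hky
      exact hky
    have h2 : (k : ℝ) * N ≤ 2 * (k ^ 2 * B) := by nlinarith
    have h3 : 0 < (n : ℝ) ^ 2 := by positivity
    nlinarith

theorem rpow_one_div_rpow (p q : ℝ≥0∞) [hp : Fact (1 ≤ p)] (hp' : p ≠ ∞) {x : ℝ} (hx : 0 ≤ x) :
    (x ^ (1 / p.toReal)) ^ (1 - p.toReal / q.toReal) = x ^ (1 / p.toReal - 1 / q.toReal) := by
  have hp0 := LpN.toReal_pos_of_one_le hp.out hp'
  rw [← Real.rpow_mul hx, mul_sub, mul_one, one_div_mul_eq_div, div_div_cancel_left' hp0.ne',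
    one_div q.toReal]

theorem log_four_mul_le {n N : ℕ} (hn : 1 ≤ n) (hN : 1 ≤ N) :
    Real.log (4 * N) ≤ 3 * Real.logb 2 (N + n) ∧ 1 ≤ Real.logb 2 (N + n) := by
  have hn1 : (1 : ℝ) ≤ n := by exact_mod_cast hn
  have hN1 : (1 : ℝ) ≤ N := by exact_mod_cast hN
  have h1 : 1 ≤ Real.logb 2 (N + n) := by
    rw [Real.le_logb_iff_rpow_le (by norm_num) (by positivity)]
    norm_num
    linarith
  refine ⟨?_, h1⟩
  have h2 : Real.log (4 * N) = 2 * Real.log 2 + Real.log N := by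
    rw [Real.log_mul (by norm_num) (by positivity), show (4 : ℝ) = 2 ^ 2 by norm_num, Real.log_pow]
    norm_num
  have h3 : Real.log N ≤ Real.log (N + n) := Real.log_le_log (by positivity) (by linarith)
  have h4 : Real.log (N + n) = Real.logb 2 (N + n) * Real.log 2 := by
    rw [Real.logb, div_mul_cancel₀ _ (Real.log_pos (by norm_num)).ne']
  have h5 := Real.log_two_lt_d9
  have h6 := Real.log_two_gt_d9
  rw [h2]
  nlinarith

theorem embedError_le_of_lt (p q : ℝ≥0∞) [hp : Fact (1 ≤ p)] [Fact (1 ≤ q)] (hpq : p < q) {n N : ℕ}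
    (hn : 1 ≤ n) (hN : 1 ≤ N) (h : n ≤ N) (ha : 0 ≤ 1 / p.toReal - 1 / q.toReal) :
    embedError p q n N ≤ ENNReal.ofReal ((259200 : ℝ) ^ (1 / p.toReal - 1 / q.toReal) *
      Real.logb 2 (N + n) ^ (2 * (1 / p.toReal - 1 / q.toReal)) *
      min (((N : ℝ) / n) ^ (2 * (1 / p.toReal - 1 / q.toReal)))
        ((N : ℝ) ^ (1 / p.toReal - 1 / q.toReal))) := by
  have hp' : p ≠ ∞ := hpq.ne_top
  have hn0 : (0 : ℝ) < n := by exact_mod_cast hn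
  have hn1 : (1 : ℝ) ≤ n := by exact_mod_cast hn
  have hN0 : (0 : ℝ) < N := by exact_mod_cast hN
  have hN1 : (1 : ℝ) ≤ N := by exact_mod_cast hN
  have hnN : (n : ℝ) ≤ N := by exact_mod_cast h
  obtain ⟨hl, hl1⟩ := log_four_mul_le hn hN
  set a := 1 / p.toReal - 1 / q.toReal with haa
  set L := Real.logb 2 (N + n) with hL
  set l := Real.log (4 * N) with hll
  have hl0 : 1 ≤ l := by
    rw [hll, Real.le_log_iff_exp_le (by positivity)]
    have := Real.exp_one_lt_d9
    linarith
  -- `V` is `N/K` for the search and `N` for the output `0`; its two bounds yield the two terms of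
  -- the minimum. Here `259200 = 120² * 9 * 2`, with `9` from `l ≤ 3 L` and `2` from rounding `x`
  -- down.
  have key : ∃ V : ℝ, 0 ≤ V ∧ V ≤ N ∧ V ≤ 259200 * L ^ 2 * (N / n) ^ 2 ∧
      embedError p q n N ≤ ENNReal.ofReal (V ^ a) := by
    set x : ℝ := n ^ 2 / (14400 * l ^ 2 * N) with hx
    have hx0 : 0 < x := by positivity
    have hll2 : l ^ 2 ≤ 9 * L ^ 2 := by nlinarith
    rcases lt_or_ge x 1 with hx1 | hx1
    · refine ⟨N, hN0.le, le_rfl, ?_, ?_⟩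
      · rw [hx, div_lt_one (by positivity)] at hx1
        rw [div_pow, mul_div_assoc', le_div_iff₀ (by positivity)]
        have h1 : (n : ℝ) ^ 2 ≤ 259200 * L ^ 2 * N := by nlinarith
        nlinarith
      · refine embedError_le_of_norm_le p q hN (by positivity) fun f hf => ?_
        rw [haa, ← rpow_one_div_rpow p q hp' hN0.le]
        exact LpN.norm_le_rpow hp.out hpq hN (by positivity) hf
          (LpN.abs_le_of_norm_le_one hp.out hp' hN hf) fun i => le_rfl
    · set K := ⌊x⌋₊ with hK
      have hK1 : 1 ≤ K := (Nat.one_le_floor_iff x).2 hx1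
      have hKx : (K : ℝ) ≤ x := Nat.floor_le hx0.le
      have hKx' : x < K + 1 := Nat.lt_floor_add_one x
      have hK1' : (1 : ℝ) ≤ K := by exact_mod_cast hK1
      have hxn : x * (14400 * l ^ 2 * N) = n ^ 2 := by
        rw [hx]; field_simp
      have hKn : K * (14400 * l ^ 2 * N) ≤ n ^ 2 := by
        rw [← hxn]; gcongr
      have hKN : (K : ℝ) ≤ N := by
        have h1 : (1 : ℝ) ≤ 14400 * l ^ 2 := by nlinarith
        have h2 : K * (1 * N) ≤ K * (14400 * l ^ 2 * N) := by gcongr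
        have h3 : (K : ℝ) * N ≤ N * N := by nlinarith
        exact le_of_mul_le_mul_right h3 hN0
      refine ⟨N / K, by positivity, div_le_self hN0.le hK1', ?_, ?_⟩
      · rw [div_le_iff₀ (by positivity)]
        have h1 : x ≤ 2 * K := by linarith
        have h2 : (n : ℝ) ^ 2 ≤ 2 * K * (14400 * (9 * L ^ 2) * N) := by
          rw [← hxn]; gcongr
        rw [div_pow]
        have h3 : 259200 * L ^ 2 * ((N : ℝ) ^ 2 / n ^ 2) * K =
          N * (2 * K * (14400 * (9 * L ^ 2) * N)) / n ^ 2 := by ring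
        rw [h3, le_div_iff₀ (by positivity)]
        gcongr
      · rw [haa, ← rpow_one_div_rpow p q hp' (by positivity)]
        refine embedError_le_of_search p q hpq hN hK1 (by exact_mod_cast hKN) ?_
        refine abs_le_of_sq_le_sq' ?_ hn0.le |>.2
        rw [mul_pow, Real.sq_sqrt (by positivity)]
        refine le_trans (le_of_eq ?_) hKn
        ring
  obtain ⟨V, hV0, hV1, hV2, hV3⟩ := key
  refine hV3.trans (ENNReal.ofReal_le_ofReal ?_)
  rw [mul_min_of_nonneg _ _ (by positivity)]
  refine le_min ?_ ?_
  · refine (Real.rpow_le_rpow hV0 hV2 ha).trans (le_of_eq ?_)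
    rw [Real.mul_rpow (by positivity) (by positivity), Real.mul_rpow (by positivity)
      (by positivity), Real.rpow_mul (by positivity), Real.rpow_mul (by positivity)]
    norm_num
  · refine (Real.rpow_le_rpow hV0 hV1 ha).trans (le_mul_of_one_le_left (by positivity) ?_)
    exact one_le_mul_of_one_le_of_one_le (Real.one_le_rpow (by norm_num) ha)
      (Real.one_le_rpow hl1 (by linarith))

theorem one_div_toReal_le {p q : ℝ≥0∞} (hp : 1 ≤ p) (hpq : p ≤ q) :
    1 / q.toReal ≤ 1 / p.toReal := by
  have h := ENNReal.toReal_mono (b := p⁻¹) (by simpa using (zero_lt_one.trans_le hp).ne')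
    (ENNReal.inv_le_inv.2 hpq)
  simpa [ENNReal.toReal_inv] using h

end QuantumApprox
end
open QuantumApprox in
theorem theorem1 (p q : ℝ≥0∞) [Fact (1 ≤ p)] [Fact (1 ≤ q)] :
    (p < q → AsympLog (fun n N => embedError p q n N)
      (fun n N => min (((N : ℝ) / n) ^ ((2 / p).toReal - (2 / q).toReal))
        ((N : ℝ) ^ ((1 / p).toReal - (1 / q).toReal)))) ∧
    (q ≤ p → AsympLog (fun n N => embedError p q n N) (fun _ _ => 1)) := by
  have hp := Fact.out (p := 1 ≤ p)
  have hq := Fact.out (p := 1 ≤ q)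
  constructor
  · intro hpq
    have ha : 0 ≤ 1 / p.toReal - 1 / q.toReal := sub_nonneg.2 (one_div_toReal_le hp hpq.le)
    have h1 : (1 / p).toReal - (1 / q).toReal = 1 / p.toReal - 1 / q.toReal := by
      simp
    have h2 : (2 / p).toReal - (2 / q).toReal = 2 * (1 / p.toReal - 1 / q.toReal) := by
      simp only [ENNReal.toReal_div, ENNReal.toReal_ofNat]
      ring
    -- The lower bound needs no logarithm, so `α₁ = 0`; only the repetitions of the search lose one.
    refine ⟨1 / 3000, 1 / 8 * (1 / 400000 : ℝ) ^ (1 / p.toReal - 1 / q.toReal),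
      (259200 : ℝ) ^ (1 / p.toReal - 1 / q.toReal), 1, 0, 2 * (1 / p.toReal - 1 / q.toReal),
      by norm_num, by positivity, by positivity, le_rfl, ?_⟩
    intro n N hn hN _ hnN
    rw [h1, h2, Real.rpow_zero, mul_one]
    refine ⟨le_embedError_of_lt p q hn hnN ha, embedError_le_of_lt p q hpq hn hN ?_ ha⟩
    have : (n : ℝ) ≤ N := hnN.trans (by
      have : (0 : ℝ) ≤ N := Nat.cast_nonneg N
      linarith)
    exact_mod_cast this
  · intro hqp
    have ha : 1 / p.toReal - 1 / q.toReal ≤ 0 := sub_nonpos.2 (one_div_toReal_le hq hqp)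
    refine ⟨1 / 3000, 1 / 8 * (32 : ℝ) ^ (1 / p.toReal - 1 / q.toReal), 1, 1, 0, 0,
      by norm_num, by positivity, one_pos, le_rfl, ?_⟩
    intro n N hn hN _ hnN
    simp only [Real.rpow_zero, mul_one]
    exact ⟨le_embedError_of_le p q hn hnN ha,
      embedError_le_of_norm_le p q hN zero_le_one fun f hf => LpN.norm_le_one_of_le hq hqp hN hf⟩
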